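/- **Model.** A college admissions instance with weak preferences (CAW) consists of a finite set $P=\{p_1,\dots,p_{|P|}\}$ of students, a finite set $Q$ of colleges, for every $p\in P$ a transitive total relation $\succeq_p$ on $Q\cup\{\varnothing\}$, for every $q\in Q$ a transitive total relation $\succeq_q$ on $P\cup\{\varnothing\}$, and capacities $c_q\in\mathbb Z_{>0}$; $\varnothing$ means "unmatched", and $\succ$ denotes asymmetric parts. A matching is a map $\mu:P\to Q\cup\{\varnothing\}$ with $|\mu(q)|\le c_q$ for all $q\in Q$, where $\mu(q)=\{p:\mu(p)=q\}$. It is *weakly stable* if (individual rationality) $\mu(p)=q\in Q$ implies $q\succeq_p\varnothing$ and $p\succeq_q\varnothing$, and there is no pair $(p',q)\in P\times Q$ with $q\succ_{p'}\mu(p')$ such that $p'\succ_q p$ for some $p\in\mu(q)$, or $|\mu(q)|<c_q$ and $p'\succ_q\varnothing$. Given group preferences $\succeq'_q$ on $2^P$, write $\mu\succeq\mu'$ if $\mu(p)\succeq_p\mu'(p)$ for all $p\in P$ and $\mu(q)\succeq'_q\mu'(q)$ for all $q\in Q$; $\mu$ is *Pareto-optimal* if there is no matching $\mu'$ with $\mu'\succeq\mu$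 and not $\mu\succeq\mu'$, and *Pareto-stable* if it is Pareto-optimal and weakly stable. **Group preferences.** A reflexive transitive relation $\succeq'_q$ on $2^P$ is *responsive* to $\succeq_q$ if for all $S\subseteq P$ and all $x,y\in(P\setminus S)\cup\{\varnothing\}$ we have $x\succeq_q y$ if and only if $S\cup\{x\}\succeq'_q S\cup\{y\}$, where $S\cup\{\varnothing\}$ stands for $S$. It is *one-sided responsive* if this is required only for $x\in P\setminus S$ (and all $y\in(P\setminus S)\cup\{\varnothing\}$). It is *minimally* (one-sided) responsive if it is (one-sided) responsive and does not strictly contain another (one-sided) responsive relation. It is *induced by the additive utility* $\psi_q$ if $S\succeq'_q S'\iff\sum_{p\in S}\psi_q(p)\ge\sum_{p\in S'}\psi_q(p)$. **Algorithm.** Fix a utility assignment: for each college $q$ a function $\psi_q:P\cup\{\varnothing\}\to\mathbb R$ with $\psi_q(\varnothing)=0$ and $x\succeq_q y\iff\psi_q(x)\ge\psi_q(y)$, not depending on the students' preferences. Split every college $q$ into $c_q$ slots, each with the utilities $\psi_q$; students compare slots by their colleges. The items are all slots, and one dummy item $d_i$ for each student $p_i$, which represents $\varnothing$ for $p_i$.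 For each student $p_i$, partition the slots and $\varnothing$ into the indifference classes (tiers) of $p_i$, from best to worst, and form one bidder for each tier: it has priority $i$, bids $\psi_q(p_i)$ on each slot of each college $q$ in the tier, and bids $0$ on $d_i$ if $\varnothing$ is in the tier. For a set $U$ of bidders consider the bipartite graph between $U$ and the items whose edges are the bids, weighted by their amounts. A *greedy* maximum-weight matching (MWM) is an MWM whose set of matched bidders has maximum total priority among the inclusion-maximal sets in the family of subsets of $U$ that can be simultaneously matched by an MWM. Start with $U=\emptyset$. While some student $p_i$ has a bidder outside $U$ and no bidder of priority $i$ is matched in a greedy MWM for $U$, choose such a student arbitrarily and add that student's next bidder to $U$. At the end choose an arbitrary greedy MWM $M_0$ for $U$, and return $\mu$, where $\mu(p_i)$ is the college of the slot, or $\varnothing$ if it is $d_i$, to which a bidder of $p_i$ is matched in $M_0$. **Theorem.** Fix any utility assignment as above, and suppose that for every college $q$ the group preference $\succeq'_q$ is (a) minimally responsive to $\succeq_q$; or (b) minimally one-sided responsive to $\succeq_q$, where $q$ is not indifferent between any student and $\varnothing$; or (c) induced by the additive utility $\psi_q$ that the algorithm uses. Then the algorithm is a Pareto-stable mechanism that is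 strategyproof for the students: 1. The loop terminates for all choices, the final set $U$ does not depend on the choices, a greedy MWM for $U$ exists, and for each greedy MWM $M_0$ the returned $\mu$ is well defined and is a matching. 2. Every matching that the algorithm can return is Pareto-stable. 3. If $\mu$ is a possible output for the true preferences and $\mu'$ is a possible output when one student $p$ reports an arbitrary transitive total relation on $Q\cup\{\varnothing\}$ instead of $\succeq_p$, all other inputs (including the utility assignment) being the same, then $\mu(p)\succeq_p\mu'(p)$. -/

import Mathlib

/-! ### Weak preferences -/

/-- A weak preference relation: transitive and total, not necessarily antisymmetric.
`r.ge x y` says that `x` is at least as good as `y`. -/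
structure WeakPref (α : Type*) where
  ge : α → α → Prop
  trans : ∀ x y z, ge x y → ge y z → ge x z
  total : ∀ x y, ge x y ∨ ge y x

namespace WeakPref

variable {α β : Type*}

/-- The asymmetric part. -/
def gt (r : WeakPref α) (x y : α) : Prop := r.ge x y ∧ ¬ r.ge y x

/-- The symmetric part. -/
def indiff (r : WeakPref α) (x y : α) : Prop := r.ge x y ∧ r.ge y x

/-- The preference relation on `β` obtained by comparing the images under `f : β → α`. -/
def comap (f : β → α) (r : WeakPref α) : WeakPref β where
  ge x y := r.ge (f x) (f y)
  trans _ _ _ := r.trans _ _ _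
  total _ _ := r.total _ _

open scoped Classical in
/-- The indifference class of `x`. -/
noncomputable def cls [Fintype α] (r : WeakPref α) (x : α) : Finset α :=
  Finset.univ.filter fun y => r.indiff x y

open scoped Classical in
/-- The number of tiers (indifference classes). -/
noncomputable def numTiers [Fintype α] (r : WeakPref α) : ℕ :=
  (Finset.univ.image fun x => r.cls x).card

open scoped Classical in
/-- The tier number of `x`, counted from `0`: the number of tiers that are strictly preferred to
the tier of `x`. -/
noncomputable def tier [Fintype α] (r : WeakPref α) (x : α) : ℕ :=
  ((Finset.univ.filter fun y => r.gt y x).image fun y => r.cls y).card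

end WeakPref

/-! ### Unit-demand auctions with priorities -/

/-- A unit-demand auction with priorities. Bidders are named by their IDs, which are elements of
`ι`; `V` is the set of items. The bid of a bidder is a partial function from items to reals. -/
structure UAP (ι V : Type*) where
  bidders : Finset ι
  bid : ι → V → Option ℝ
  priority : ι → ℝ

namespace UAP

variable {ι V : Type*}

/-- A matching of the bipartite graph with an edge `(u, v)` whenever the bidder `u` bids on `v`. -/
structure IsMatching (A : UAP ι V) (M : Finset (ι × V)) : Prop where
  bidder_mem : ∀ e ∈ M, e.1 ∈ A.bidders
  edge : ∀ e ∈ M, (A.bid e.1 e.2).isSome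
  bidder_inj : ∀ e ∈ M, ∀ e' ∈ M, e.1 = e'.1 → e = e'
  item_inj : ∀ e ∈ M, ∀ e' ∈ M, e.2 = e'.2 → e = e'

/-- The weight of a set of edges. (All pairs in a matching carry a bid, so that the default value
is never used there.) -/
noncomputable def weight (A : UAP ι V) (M : Finset (ι × V)) : ℝ :=
  ∑ e ∈ M, (A.bid e.1 e.2).getD 0

/-- Maximum-weight matchings. -/
def IsMWM (A : UAP ι V) (M : Finset (ι × V)) : Prop :=
  A.IsMatching M ∧ ∀ M', A.IsMatching M' → A.weight M' ≤ A.weight M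

open scoped Classical in
/-- The set of bidders matched by `M`. -/
noncomputable def matched (M : Finset (ι × V)) : Finset ι := M.image Prod.fst

/-- The independent sets of the matroid of `A`: the sets of bidders that can be simultaneously
matched by a maximum-weight matching. -/
def Indep (A : UAP ι V) (S : Finset ι) : Prop :=
  S ⊆ A.bidders ∧ ∃ M, A.IsMWM M ∧ S ⊆ matched M

/-- The maximal independent sets of the matroid of `A`. -/
def IsBasis (A : UAP ι V) (S : Finset ι) : Prop :=
  A.Indep S ∧ ∀ S', A.Indep S' → S ⊆ S' → S' = S

/-- Greedy maximum-weight matchings: the set of matched bidders is a maximum-priority maximal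
independent set. -/
def IsGreedyMWM (A : UAP ι V) (M : Finset (ι × V)) : Prop :=
  A.IsMWM M ∧ A.IsBasis (matched M) ∧
    ∀ S, A.IsBasis S → ∑ u ∈ S, A.priority u ≤ ∑ u ∈ matched M, A.priority u

open scoped Classical in
/-- `k` is the number of bidders of priority `z` matched in a greedy maximum-weight matching. -/
def IsGreedyCount (A : UAP ι V) (z : ℝ) (k : ℕ) : Prop :=
  ∀ M, A.IsGreedyMWM M → ((matched M).filter fun u => A.priority u = z).card = k

end UAP

/-! ### Iterated unit-demand auctions with priorities -/

/-- An iterated unit-demand auction with priorities. The multibidder `t` has a sequence of `len t`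
bidders, all of priority `priority t`; distinct multibidders have distinct priorities. -/
structure IUAP (T V : Type*) where
  len : T → ℕ
  bid : (t : T) → Fin (len t) → V → Option ℝ
  priority : T → ℝ
  priority_injective : Function.Injective priority

namespace IUAP

variable {T V : Type*}

/-- The bidders of all multibidders: `⟨t, k⟩` is the bidder in position `k` (counted from `0`) of
the sequence of `t`. -/
abbrev Bidder (B : IUAP T V) : Type _ := Σ t : T, Fin (B.len t)

/-- The auction formed by the revealed bidders `U`. -/
def toUAP (B : IUAP T V) (U : Finset B.Bidder) : UAP B.Bidder V where
  bidders := U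
  bid u := B.bid u.1 u.2
  priority u := B.priority u.1

open scoped Classical in
/-- When the bidders in `U` are the revealed ones, `u` is ready if no bidder with its priority is
matched in a greedy maximum-weight matching, and `u` is the next bidder of its multibidder. -/
def Ready (B : IUAP T V) (U : Finset B.Bidder) (u : B.Bidder) : Prop :=
  (B.toUAP U).IsGreedyCount (B.priority u.1) 0 ∧
    (u.2 : ℕ) = (U.filter fun u' => u'.1 = u.1).card

open scoped Classical in
/-- One iteration of the loop: an arbitrary ready bidder is revealed. -/
def Step (B : IUAP T V) (U U' : Finset B.Bidder) : Prop :=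
  ∃ u, B.Ready U u ∧ U' = insert u U

/-- `U` is the set of revealed bidders at the end of some execution of the loop that starts with
no revealed bidder and runs while a bidder is ready. -/
def IsFinal (B : IUAP T V) (U : Finset B.Bidder) : Prop :=
  Relation.ReflTransGen B.Step ∅ U ∧ ∀ u, ¬ B.Ready U u

/-- No execution of the loop goes on forever. -/
def Terminates (B : IUAP T V) : Prop :=
  ¬ ∃ f : ℕ → Finset B.Bidder, f 0 = ∅ ∧ ∀ n, B.Step (f n) (f (n + 1))

end IUAP

/-! ### Stable marriage with incomplete and weak preferences -/

/-- A set `M` of men and a set `W` of women, with weak preferences; `none` means unmatched. -/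
structure SMIW (M W : Type*) where
  manPref : M → WeakPref (Option W)
  womanPref : W → WeakPref (Option M)

namespace SMIW

variable {M W : Type*}

/-- Utilities that represent the preferences of the women and vanish at `none`. -/
def IsUtilityAssignment (I : SMIW M W) (ψ : W → Option M → ℝ) : Prop :=
  ∀ w, ψ w none = 0 ∧ ∀ x y, (I.womanPref w).ge x y ↔ ψ w y ≤ ψ w x

/-- The items are the women and one dummy item for each man. Being unmatched corresponds, for the
man `i`, to the dummy item of `i`. -/
def item (i : M) : Option W → W ⊕ M
  | some w => Sum.inl w
  | none => Sum.inr i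

open scoped Classical in
/-- The bid of the bidder of man `i` for his tier `k`: the women in this tier, at their utility for
`i`, and the dummy item of `i`, at `0`, if being unmatched is in this tier. -/
noncomputable def bid [Fintype W] (I : SMIW M W) (ψ : W → Option M → ℝ) (i : M) (k : ℕ) :
    W ⊕ M → Option ℝ
  | Sum.inl w => if (I.manPref i).tier (some w) = k then some (ψ w (some i)) else none
  | Sum.inr i' => if i' = i ∧ (I.manPref i).tier none = k then some 0 else none

/-- The iterated auction constructed from the marriage instance: one multibidder for each man, with
one bidder for each tier of his preferences and with priority equal to his index in
`1, 2, ..., |M|`. -/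
noncomputable def toIUAP [Fintype M] [Fintype W] (I : SMIW M W) (idx : M ≃ Fin (Fintype.card M))
    (ψ : W → Option M → ℝ) : IUAP M (W ⊕ M) where
  len i := (I.manPref i).numTiers
  bid i k := I.bid ψ i k
  priority i := ((idx i : ℕ) : ℝ) + 1
  priority_injective := by
    intro i j h
    have h1 : ((idx i : ℕ) : ℝ) = ((idx j : ℕ) : ℝ) := add_right_cancel h
    exact idx.injective (Fin.ext (Nat.cast_injective h1))

/-- `(U, M₀)` is a run of the marriage algorithm: `U` is the final set of revealed bidders and `M₀`
is a greedy maximum-weight matching of the resulting auction. -/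
def IsRun [Fintype M] [Fintype W] (I : SMIW M W) (idx : M ≃ Fin (Fintype.card M))
    (ψ : W → Option M → ℝ) (U : Finset (I.toIUAP idx ψ).Bidder)
    (M₀ : Finset ((I.toIUAP idx ψ).Bidder × (W ⊕ M))) : Prop :=
  (I.toIUAP idx ψ).IsFinal U ∧ ((I.toIUAP idx ψ).toUAP U).IsGreedyMWM M₀

/-- The assignment `μ₀` of men to women (or to `none`) is the one read off from `M₀`. -/
def Reads [Fintype M] [Fintype W] (I : SMIW M W) (idx : M ≃ Fin (Fintype.card M))
    (ψ : W → Option M → ℝ) (M₀ : Finset ((I.toIUAP idx ψ).Bidder × (W ⊕ M)))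
    (μ₀ : M → Option W) : Prop :=
  ∀ (i : M) (x : Option W), μ₀ i = x ↔
    ∃ k : Fin ((I.toIUAP idx ψ).len i), ((⟨i, k⟩ : (I.toIUAP idx ψ).Bidder), item i x) ∈ M₀

end SMIW

/-! ### College admissions with weak preferences -/

/-- A set `P` of students and a set `Q` of colleges with positive capacities, and weak preferences
over individuals; `none` means unmatched. -/
structure CAW (P Q : Type*) where
  studentPref : P → WeakPref (Option Q)
  collegePref : Q → WeakPref (Option P)
  capacity : Q → ℕ
  capacity_pos : ∀ q, 0 < capacity q

namespace CAW

variable {P Q : Type*}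

/-! Matchings and stability -/

open scoped Classical in
/-- The set of students assigned to the college `q`. -/
noncomputable def group [Fintype P] (μ : P → Option Q) (q : Q) : Finset P :=
  Finset.univ.filter fun p => μ p = some q

/-- Capacitated matchings. -/
def IsMatching [Fintype P] (I : CAW P Q) (μ : P → Option Q) : Prop :=
  ∀ q, (group μ q).card ≤ I.capacity q

def IndividuallyRational (I : CAW P Q) (μ : P → Option Q) : Prop :=
  ∀ p q, μ p = some q → (I.studentPref p).ge (some q) none ∧ (I.collegePref q).ge (some p) none

def StronglyBlocks [Fintype P] (I : CAW P Q) (μ : P → Option Q) (p' : P) (q : Q) : Prop :=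
  (I.studentPref p').gt (some q) (μ p') ∧
    ((∃ p, μ p = some q ∧ (I.collegePref q).gt (some p') (some p)) ∨
      ((group μ q).card < I.capacity q ∧ (I.collegePref q).gt (some p') none))

def WeaklyStable [Fintype P] (I : CAW P Q) (μ : P → Option Q) : Prop :=
  I.IndividuallyRational μ ∧ ∀ p q, ¬ I.StronglyBlocks μ p q

/-- Every student and every college (by its group preference `G q`) finds `μ` at least as good
as `μ'`. -/
def AllGe [Fintype P] (I : CAW P Q) (G : Q → Finset P → Finset P → Prop)
    (μ μ' : P → Option Q) : Prop :=
  (∀ p, (I.studentPref p).ge (μ p) (μ' p)) ∧ ∀ q, G q (group μ q) (group μ' q)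

def ParetoDominates [Fintype P] (I : CAW P Q) (G : Q → Finset P → Finset P → Prop)
    (μ μ' : P → Option Q) : Prop :=
  I.AllGe G μ μ' ∧ ¬ I.AllGe G μ' μ

def ParetoOptimal [Fintype P] (I : CAW P Q) (G : Q → Finset P → Finset P → Prop)
    (μ : P → Option Q) : Prop :=
  ∀ μ', I.IsMatching μ' → ¬ I.ParetoDominates G μ' μ

def ParetoStable [Fintype P] (I : CAW P Q) (G : Q → Finset P → Finset P → Prop)
    (μ : P → Option Q) : Prop :=
  I.ParetoOptimal G μ ∧ I.WeaklyStable μ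

/-! The algorithm -/

/-- Utilities that represent the preferences of the colleges over individuals and vanish
at `none`. -/
def IsUtilityAssignment (I : CAW P Q) (ψ : Q → Option P → ℝ) : Prop :=
  ∀ q, ψ q none = 0 ∧ ∀ x y, (I.collegePref q).ge x y ↔ ψ q y ≤ ψ q x

/-- The slots of the colleges. -/
abbrev Slot (I : CAW P Q) : Type _ := Σ q : Q, Fin (I.capacity q)

/-- The marriage instance: a man for each student, a woman for each slot, with the preferences
inherited from the students and the colleges. -/
def toSMIW (I : CAW P Q) : SMIW P I.Slot where
  manPref p := (I.studentPref p).comap (Option.map Sigma.fst)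
  womanPref s := I.collegePref s.1

/-- All slots of a college have the utilities of the college. -/
def slotUtility (I : CAW P Q) (ψ : Q → Option P → ℝ) : I.Slot → Option P → ℝ := fun s => ψ s.1

variable [Fintype P] [Fintype Q]

/-- The iterated auction to which the instance is reduced. -/
noncomputable abbrev iuap (I : CAW P Q) (idx : P ≃ Fin (Fintype.card P))
    (ψ : Q → Option P → ℝ) : IUAP P (I.Slot ⊕ P) :=
  I.toSMIW.toIUAP idx (I.slotUtility ψ)

/-- The algorithm returns `μ` when it has chosen the greedy maximum-weight matching `M₀`. -/
def Returns (I : CAW P Q) (idx : P ≃ Fin (Fintype.card P)) (ψ : Q → Option P → ℝ)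
    (M₀ : Finset ((I.iuap idx ψ).Bidder × (I.Slot ⊕ P))) (μ : P → Option Q) : Prop :=
  ∃ μ₀ : P → Option I.Slot, I.toSMIW.Reads idx (I.slotUtility ψ) M₀ μ₀ ∧
    ∀ p, μ p = (μ₀ p).map Sigma.fst

/-- `μ` is returned by some execution of the algorithm. -/
def IsOutput (I : CAW P Q) (idx : P ≃ Fin (Fintype.card P)) (ψ : Q → Option P → ℝ)
    (μ : P → Option Q) : Prop :=
  ∃ U M₀, I.toSMIW.IsRun idx (I.slotUtility ψ) U M₀ ∧ I.Returns idx ψ M₀ μ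

/-- The algorithm is well defined on the instance and produces a matching: the loop that
reveals bidders always terminates and its final state does not depend on the choices made, a
greedy maximum-weight matching exists, and, whichever is chosen, exactly one assignment is
returned and it is a matching. -/
def ProducesMatching (I : CAW P Q) (idx : P ≃ Fin (Fintype.card P)) (ψ : Q → Option P → ℝ) :
    Prop :=
  (I.iuap idx ψ).Terminates ∧ (∃! U, (I.iuap idx ψ).IsFinal U) ∧
    (∀ U, (I.iuap idx ψ).IsFinal U → ∃ M₀, ((I.iuap idx ψ).toUAP U).IsGreedyMWM M₀) ∧
      ∀ U M₀, I.toSMIW.IsRun idx (I.slotUtility ψ) U M₀ →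
        ∃ μ, I.IsMatching μ ∧ ∀ ν, I.Returns idx ψ M₀ ν ↔ ν = μ

open scoped Classical in
/-- The instance in which the student `p` reports the preference `r`, all else being unchanged. -/
noncomputable def misreport (I : CAW P Q) (p : P) (r : WeakPref (Option Q)) : CAW P Q where
  studentPref := Function.update I.studentPref p r
  collegePref := I.collegePref
  capacity := I.capacity
  capacity_pos := I.capacity_pos

end CAW

/-! ### Group preferences -/

section GroupPreferences

variable {P : Type*}

open scoped Classical in
/-- `S ∪ {x}`, where `S ∪ {∅}` stands for `S`. -/
noncomputable def addOpt (S : Finset P) : Option P → Finset P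
  | some p => insert p S
  | none => S

/-- Responsiveness of a group preference `G` to the individual preference `r`. A vacancy is
treated like an additional student: exchanging one occupant (or vacancy) for another is an
improvement of the group exactly if it is an improvement with respect to `r`. -/
structure Responsive (r : WeakPref (Option P)) (G : Finset P → Finset P → Prop) : Prop where
  refl : ∀ S, G S S
  trans : ∀ S₁ S₂ S₃, G S₁ S₂ → G S₂ S₃ → G S₁ S₃
  iff : ∀ (S : Finset P) (x y : Option P), (∀ p ∈ S, x ≠ some p) → (∀ p ∈ S, y ≠ some p) →
    (r.ge x y ↔ G (addOpt S x) (addOpt S y))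

/-- Responsive, and not strictly containing another responsive relation. -/
def MinimallyResponsive (r : WeakPref (Option P)) (G : Finset P → Finset P → Prop) : Prop :=
  Responsive r G ∧
    ∀ G', Responsive r G' → (∀ S S', G' S S' → G S S') → ∀ S S', G S S' → G' S S'

open scoped Classical in
/-- The one-sided variant of responsiveness, which says nothing about when `S` is at least as good
as `S ∪ {p}`. -/
structure OneSidedResponsive (r : WeakPref (Option P)) (G : Finset P → Finset P → Prop) :
    Prop where
  refl : ∀ S, G S S
  trans : ∀ S₁ S₂ S₃, G S₁ S₂ → G S₂ S₃ → G S₁ S₃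
  iff_vacancy : ∀ (S : Finset P) (p : P), p ∉ S → (r.ge (some p) none ↔ G (insert p S) S)
  iff_swap : ∀ (S : Finset P) (p p' : P), p ∉ S → p' ∉ S →
    (r.ge (some p) (some p') ↔ G (insert p S) (insert p' S))

/-- One-sided responsive, and not strictly containing another such relation. -/
def MinimallyOneSidedResponsive (r : WeakPref (Option P)) (G : Finset P → Finset P → Prop) :
    Prop :=
  OneSidedResponsive r G ∧
    ∀ G', OneSidedResponsive r G' → (∀ S S', G' S S' → G S S') → ∀ S S', G S S' → G' S S'

/-- The group preference induced by the additive utility `u`. -/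
def InducedByAdditive (u : Option P → ℝ) (G : Finset P → Finset P → Prop) : Prop :=
  ∀ S S', G S S' ↔ ∑ p ∈ S', u (some p) ≤ ∑ p ∈ S, u (some p)

end GroupPreferences

/-! A state of the loop is a function `c` counting the revealed bidders of each student. Since
priorities are positive, the greedy maximum-weight matchings of a state are its matchings that are
lexicographically maximal in (total value, total priority).

Everything rests on one exchange principle. Let `M` be optimal for `c` and `M'` for `c'`, and
recombine their edges along an alternating path into `N` and `N'`. If `N` and `N'` are feasible for
`c` and `c'`, neither may beat its optimum, while the combined totals are unchanged; so `N` is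
optimal too (`exists_alternating_exchange`, `optimal_of_sum_eq`).

For `c ≤ c'` it follows that a revealed bidder matched by no optimal matching stays so. Hence only
the last revealed bidder of a student is ever matched, waiting students keep waiting, and the final
state does not depend on the choices. The dummy items ensure that every student is matched at the
end, in tier `c i - 1`.

Stability follows by inserting or swapping one edge. For Pareto optimality, the output maximizes
total utility among assignments that no student finds worse, and each admissible group preference is
monotone in utility (`UtilityMonotone`), so a dominating matching has the same total and the
domination can be reversed.

For strategyproofness, suppose a lie helps, let `R` be the set of students who truly prefer the
outcome of the lie, and stop the truthful run just before the last reveal for a student in `R`. The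
exchange lemma, with one more starting point than forbidden endpoints, makes a bidder matched that
cannot be matched there (`le_rank_of_misreport`). -/

section Exchange

/-! ### Alternating paths between two bipartite matchings -/

variable {E ι V : Type*}

theorem injOn_insert_of_ne [DecidableEq E] {β : Type*} {g : E → β} {a : E} {N : Finset E} (hN : Set.InjOn g N)
    (ha : ∀ x ∈ N, g x ≠ g a) : Set.InjOn g (insert a N : Finset E) := by
  rw [Finset.coe_insert, Set.injOn_insert (fun h => ha a h rfl)]
  exact ⟨hN, by rintro ⟨x, hx, h⟩; exact ha x hx h⟩

theorem insert_insert_erase_sdiff [DecidableEq ι] {D S : Finset ι} {x : ι} (u : ι) (hx : x ∈ D)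
    (hxS : x ∉ S) : insert x (insert u (D.erase x \ S)) = insert u (D \ S) := by
  ext y; grind

theorem insert_erase_erase_union [DecidableEq ι] {D : Finset ι} (S : Finset ι) {u x : ι}
    (hu : u ∈ D) (hux : u ≠ x) : insert u ((D.erase u).erase x ∪ S) = D.erase x ∪ S := by
  ext y; grind

/-- Multiple exchange along an alternating path: among more than `#B` left vertices covered by `M'`
but not by `M`, some `u` can be moved from `M'` to `M`, at the price of moving back at most one left
vertex, which is not in `B`. -/
theorem exists_alternating_exchange [DecidableEq E] [DecidableEq ι] (l : E → ι) (r : E → V) (n : ℕ) :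
    ∀ (M' M : Finset E) (A B : Finset ι), M'.card ≤ n →
    Set.InjOn l M' → Set.InjOn l M → Set.InjOn r M' → Set.InjOn r M →
    A ⊆ M'.image l → Disjoint A (M.image l) → B.card < A.card →
    ∃ u ∈ A, ∃ (N' N : Finset E) (S : Finset ι),
      Set.InjOn l N' ∧ Set.InjOn l N ∧ Set.InjOn r N' ∧ Set.InjOn r N ∧
      S.card ≤ 1 ∧ S ⊆ M.image l ∧ Disjoint S (M'.image l) ∧ Disjoint S B ∧
      N.image l = insert u (M.image l \ S) ∧ N'.image l = (M'.image l).erase u ∪ S ∧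
      N' ⊆ M' ∪ M ∧ N ⊆ M' ∪ M ∧
      ∀ f : E → ℝ, ∑ e ∈ N', f e + ∑ e ∈ N, f e = ∑ e ∈ M', f e + ∑ e ∈ M, f e := by
  induction n with
  | zero =>
    intro M' M A B hn _ _ _ _ hA _ hB
    have h0 : M' = ∅ := Finset.card_eq_zero.1 (by omega)
    subst h0
    have : A = ∅ := Finset.subset_empty.1 (by simpa using hA)
    subst this
    simp at hB
  | succ n ih =>
    intro M' M A B hn hl' hl hr' hr hA hAM hB
    -- Follow the alternating path from `u`: it begins with the `M'`-edge `e` at `u`, then uses the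
    -- `M`-edge `e'` at the same right vertex, if there is one.
    obtain ⟨u, hu⟩ : A.Nonempty := Finset.card_pos.1 (by omega)
    obtain ⟨e, he, rfl⟩ := Finset.mem_image.1 (hA hu)
    have huM : ∀ x ∈ M, l x ≠ l e := fun x hx h =>
      Finset.disjoint_left.1 hAM hu (h ▸ Finset.mem_image_of_mem l hx)
    have heM : e ∉ M := fun h => huM e h rfl
    by_cases hfree : ∃ e' ∈ M, r e' = r e
    swap
    · push Not at hfree
      -- The path ends at a right vertex that `M` leaves free, so nothing has to be moved back.
      refine ⟨l e, hu, M'.erase e, insert e M, ∅, ?_, ?_, ?_, ?_, by simp, by simp, by simp,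
        by simp, by simp, ?_, ?_, ?_, ?_⟩
      · exact hl'.mono (by simp)
      · rw [Finset.coe_insert, Set.injOn_insert (by simpa using heM)]
        exact ⟨hl, by rintro ⟨x, hx, h⟩; exact huM x hx h⟩
      · exact hr'.mono (by simp)
      · rw [Finset.coe_insert, Set.injOn_insert (by simpa using heM)]
        exact ⟨hr, by rintro ⟨x, hx, h⟩; exact hfree x hx h⟩
      · ext y
        simp only [Finset.mem_image, Finset.mem_erase, Finset.union_empty]
        constructor
        · rintro ⟨x, ⟨hxe, hx⟩, rfl⟩
          exact ⟨fun h => hxe (hl' hx he h), x, hx, rfl⟩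
        · rintro ⟨hy, x, hx, rfl⟩
          exact ⟨x, ⟨fun h => hy (h ▸ rfl), hx⟩, rfl⟩
      · intro x hx; simp only [Finset.mem_erase] at hx; simp [hx.2]
      · intro x hx
        rcases Finset.mem_insert.1 hx with rfl | hx
        · simp [he]
        · simp [hx]
      · intro f
        rw [Finset.sum_insert heM, ← Finset.add_sum_erase M' f he]
        ring
    · obtain ⟨e', he', hre⟩ := hfree
      have hx_ne : l e' ≠ l e := huM e' he'
      have hD1 : (M.erase e').image l = (M.image l).erase (l e') := by
        ext y
        simp only [Finset.mem_image, Finset.mem_erase]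
        constructor
        · rintro ⟨x, ⟨hxe, hx⟩, rfl⟩
          exact ⟨fun h => hxe (hl hx he' h), x, hx, rfl⟩
        · rintro ⟨hy, x, hx, rfl⟩
          exact ⟨x, ⟨fun h => hy (h ▸ rfl), hx⟩, rfl⟩
      have hD1' : (M'.erase e).image l = (M'.image l).erase (l e) := by
        ext y
        simp only [Finset.mem_image, Finset.mem_erase]
        constructor
        · rintro ⟨x, ⟨hxe, hx⟩, rfl⟩
          exact ⟨fun h => hxe (hl' hx he h), x, hx, rfl⟩
        · rintro ⟨hy, x, hx, rfl⟩
          exact ⟨x, ⟨fun h => hy (h ▸ rfl), hx⟩, rfl⟩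
      have hlM : l e' ∈ M.image l := Finset.mem_image_of_mem l he'
      have hlM' : l e ∈ M'.image l := Finset.mem_image_of_mem l he
      have huM2 : l e ∉ M.image l := Finset.disjoint_left.1 hAM hu
      have hr1 : ∀ x ∈ M.erase e', r x ≠ r e := fun x hx h =>
        (Finset.mem_erase.1 hx).1 (hr (Finset.mem_erase.1 hx).2 he' (h.trans hre.symm))
      have hr1' : ∀ x ∈ M'.erase e, r x ≠ r e := fun x hx h =>
        (Finset.mem_erase.1 hx).1 (hr' (Finset.mem_erase.1 hx).2 he h)
      have hcard : (M'.erase e).card ≤ n := by rw [Finset.card_erase_of_mem he]; omega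
      -- In the first case the path ends at the permitted left vertex `l e'`, and swapping `e` with
      -- `e'` suffices.
      by_cases hdir : l e' ∉ M'.image l ∧ l e' ∉ B
      · obtain ⟨hx1, hx2⟩ := hdir
        refine ⟨l e, hu, insert e' (M'.erase e), insert e (M.erase e'), {l e'}, ?_, ?_, ?_, ?_,
          by simp, by simpa using hlM, by simpa using hx1, by simpa using hx2, ?_, ?_, ?_, ?_, ?_⟩
        · exact injOn_insert_of_ne (hl'.mono (by simp)) fun x hx h =>
            hx1 (h ▸ Finset.mem_image_of_mem l (Finset.mem_erase.1 hx).2)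
        · exact injOn_insert_of_ne (hl.mono (by simp)) fun x hx h => huM x (Finset.mem_erase.1 hx).2 h
        · exact injOn_insert_of_ne (hr'.mono (by simp)) fun x hx h => hr1' x hx (h.trans hre)
        · exact injOn_insert_of_ne (hr.mono (by simp)) hr1
        · rw [Finset.image_insert, hD1, Finset.sdiff_singleton_eq_erase]
        · rw [Finset.image_insert, hD1', Finset.insert_eq, Finset.union_comm]
        · intro x; simp only [Finset.mem_insert, Finset.mem_erase, Finset.mem_union]
          rintro (rfl | h) <;> tauto
        · intro x; simp only [Finset.mem_insert, Finset.mem_erase, Finset.mem_union]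
          rintro (rfl | h) <;> tauto
        · intro f
          rw [Finset.sum_insert (fun h => hx1 (Finset.mem_image_of_mem l (Finset.mem_erase.1 h).2)),
            Finset.sum_insert (fun h => heM (Finset.mem_erase.1 h).2),
            ← Finset.add_sum_erase M' f he, ← Finset.add_sum_erase M f he']
          ring
      · obtain ⟨A₁, B₁, hA₁, hA₁', hAB, hBB, hAA⟩ : ∃ A₁ B₁ : Finset ι,
            A₁ ⊆ (M'.erase e).image l ∧ Disjoint A₁ ((M.erase e').image l) ∧
            B₁.card < A₁.card ∧ B ⊆ insert (l e') B₁ ∧ ∀ y ∈ A₁, (y ∈ A ∧ y ≠ l e ∧ y ≠ l e') ∨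
              y = l e' := by
          have hdis : ∀ y ∈ A, y ∉ M.image l := fun y hy => Finset.disjoint_left.1 hAM hy
          by_cases hx1 : l e' ∈ M'.image l
          · refine ⟨insert (l e') (A.erase (l e)), B, ?_, ?_, ?_, by simp, ?_⟩
            · rw [hD1']; intro y; grind
            · rw [hD1, Finset.disjoint_left]; intro y; grind
            · rw [Finset.card_insert_of_notMem (by grind), Finset.card_erase_of_mem hu]; omega
            · intro y; grind
          · have hxB : l e' ∈ B := by tauto
            refine ⟨A.erase (l e), B.erase (l e'), ?_, ?_, ?_, ?_, ?_⟩
            · rw [hD1']; intro y; grind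
            · rw [hD1, Finset.disjoint_left]; intro y; grind
            · rw [Finset.card_erase_of_mem hu, Finset.card_erase_of_mem hxB]
              have := Finset.card_pos.2 ⟨_, hxB⟩
              omega
            · intro y; grind
            · intro y; grind
        obtain ⟨u₂, hu₂, N', N, S, k1, k2, k3, k4, k5, k6, k7, k8, k9, k10, k11, k12, k13⟩ :=
          ih (M'.erase e) (M.erase e') A₁ B₁ hcard (hl'.mono (by simp)) (hl.mono (by simp))
            (hr'.mono (by simp)) (hr.mono (by simp)) hA₁ hA₁' hAB
        have hrN' : ∀ x ∈ N', r x ≠ r e := fun x hx =>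
          (Finset.mem_union.1 (k11 hx)).elim (hr1' x) (hr1 x)
        have hrN : ∀ x ∈ N, r x ≠ r e := fun x hx =>
          (Finset.mem_union.1 (k12 hx)).elim (hr1' x) (hr1 x)
        rw [hD1] at k6 k9
        rw [hD1'] at k7 k10
        have hSx : l e' ∉ S := fun h => by simpa using k6 h
        have hSu : l e ∉ S := fun h => huM2 (Finset.mem_of_mem_erase (k6 h))
        have hS1 : S ⊆ M.image l := fun y hy => Finset.mem_of_mem_erase (k6 hy)
        have hS2 : Disjoint S (M'.image l) := by
          rw [Finset.disjoint_left] at k7 ⊢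
          intro y hy hy'
          exact k7 hy (Finset.mem_erase.2 ⟨fun h => hSu (h ▸ hy), hy'⟩)
        have hS3 : Disjoint S B := by
          rw [Finset.disjoint_left] at k8 ⊢
          intro y hy hy'
          rcases Finset.mem_insert.1 (hBB hy') with h | h
          · exact hSx (h ▸ hy)
          · exact k8 hy h
        have hmem : ∀ x ∈ M'.erase e ∪ M.erase e', x ∈ M' ∪ M := by
          intro x; simp only [Finset.mem_union, Finset.mem_erase]; tauto
        have hmem' : ∀ N₀ : Finset E, N₀ ⊆ M'.erase e ∪ M.erase e' → ∀ a, a = e ∨ a = e' →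
            insert a N₀ ⊆ M' ∪ M := by
          intro N₀ h a ha x hx
          rcases Finset.mem_insert.1 hx with rfl | hx
          · rcases ha with rfl | rfl
            · exact Finset.mem_union_left _ he
            · exact Finset.mem_union_right _ he'
          · exact hmem x (h hx)
        have hL' : ∀ {x}, x ∈ N' → l x ∈ ((M'.image l).erase (l e)).erase u₂ ∪ S :=
          fun hx => k10 ▸ Finset.mem_image_of_mem l hx
        have hL : ∀ {x}, x ∈ N → l x ∈ insert u₂ ((M.image l).erase (l e') \ S) :=
          fun hx => k9 ▸ Finset.mem_image_of_mem l hx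
        -- If the path found by the recursion starts elsewhere, `e` and `e'` return to their own
        -- sides. If it starts at `l e'`, it is prolonged to `l e` by putting them on opposite
        -- sides.
        rcases hAA u₂ hu₂ with ⟨ha1, ha2, ha3⟩ | rfl
        · have hq' : ∀ x ∈ N', l x ≠ l e := by
            intro x hx h; have := hL' hx; grind
          have hq : ∀ x ∈ N, l x ≠ l e' := by
            intro x hx h; have := hL hx; grind
          refine ⟨u₂, ha1, insert e N', insert e' N, S, injOn_insert_of_ne k1 hq', injOn_insert_of_ne k2 hq,
            injOn_insert_of_ne k3 hrN', injOn_insert_of_ne k4 fun x hx h => hrN x hx (h.trans hre),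
            k5, hS1, hS2, hS3, ?_, ?_, hmem' _ k11 _ (Or.inl rfl), hmem' _ k12 _ (Or.inr rfl), ?_⟩
          · rw [Finset.image_insert, k9, insert_insert_erase_sdiff u₂ hlM hSx]
          · rw [Finset.image_insert, k10, insert_erase_erase_union S hlM' ha2.symm]
          · intro f
            rw [Finset.sum_insert (fun h => hq' e h rfl), Finset.sum_insert (fun h => hq e' h rfl),
              ← Finset.add_sum_erase M' f he, ← Finset.add_sum_erase M f he']
            have := k13 f
            linarith
        · have hq' : ∀ x ∈ N', l x ≠ l e' := by
            intro x hx h; have := hL' hx; grind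
          have hq : ∀ x ∈ N, l x ≠ l e := by
            intro x hx h; have := hL hx; grind
          have hxM' : l e' ∈ M'.image l :=
            Finset.mem_of_mem_erase (hD1' ▸ hA₁ hu₂)
          refine ⟨l e, hu, insert e' N', insert e N, S, injOn_insert_of_ne k1 hq', injOn_insert_of_ne k2 hq,
            injOn_insert_of_ne k3 fun x hx h => hrN' x hx (h.trans hre), injOn_insert_of_ne k4 hrN,
            k5, hS1, hS2, hS3, ?_, ?_, hmem' _ k11 _ (Or.inr rfl), hmem' _ k12 _ (Or.inl rfl), ?_⟩
          · rw [Finset.image_insert, k9, Finset.insert_comm, insert_insert_erase_sdiff _ hlM hSx]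
          · rw [Finset.image_insert, k10, Finset.erase_right_comm,
              insert_erase_erase_union S hxM' hx_ne]
          · intro f
            rw [Finset.sum_insert (fun h => hq' e' h rfl), Finset.sum_insert (fun h => hq e h rfl),
              ← Finset.add_sum_erase M' f he, ← Finset.add_sum_erase M f he']
            have := k13 f
            linarith

end Exchange

/-! ### Optimal matchings of a market as bidders are revealed -/

/-- An abstract market in which every edge joins an agent to an item and carries a value. The edges
of an agent are ranked; edges of equal rank belong to the same bidder of the agent. -/
structure TieredMarket (T V E : Type*) where
  agent : E → T
  item : E → V
  rank : E → ℕ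
  value : E → ℝ
  prio : T → ℝ

namespace TieredMarket

variable {T V E : Type*}

/-- The bidder that an edge belongs to. -/
def label (A : TieredMarket T V E) (e : E) : T × ℕ := (A.agent e, A.rank e)

/-- The matchings that use only the first `c t` bidders of every agent `t`. -/
structure Feasible (A : TieredMarket T V E) (c : T → ℕ) (N : Finset E) : Prop where
  rank_lt : ∀ e ∈ N, A.rank e < c (A.agent e)
  label_inj : Set.InjOn A.label N
  item_inj : Set.InjOn A.item N

/-- The matchings with lexicographically maximum value and priority. -/
def Optimal (A : TieredMarket T V E) (c : T → ℕ) (N : Finset E) : Prop :=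
  A.Feasible c N ∧ ∀ N', A.Feasible c N' → ∑ e ∈ N', A.value e < ∑ e ∈ N, A.value e ∨
    (∑ e ∈ N', A.value e = ∑ e ∈ N, A.value e ∧
      ∑ e ∈ N', A.prio (A.agent e) ≤ ∑ e ∈ N, A.prio (A.agent e))

/-- The agent `t` is unmatched in all optimal matchings. -/
def Waiting (A : TieredMarket T V E) (c : T → ℕ) (t : T) : Prop :=
  ∀ N, A.Optimal c N → ∀ e ∈ N, A.agent e ≠ t

open scoped Classical in
/-- The next bidder of a waiting agent is revealed. -/
def Advance (A : TieredMarket T V E) (len c c' : T → ℕ) : Prop :=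
  ∃ t, c t < len t ∧ A.Waiting c t ∧ c' = Function.update c t (c t + 1)

def Reachable (A : TieredMarket T V E) (len c : T → ℕ) : Prop :=
  Relation.ReflTransGen (A.Advance len) (fun _ => 0) c

variable {A : TieredMarket T V E} {len c c' : T → ℕ} {M M' N N' : Finset E}

theorem exists_optimal [Finite E] (A : TieredMarket T V E) (c : T → ℕ) : ∃ N, A.Optimal c N := by
  classical
  have hne : {N | A.Feasible c N}.Nonempty := ⟨∅, ⟨by simp, by simp, by simp⟩⟩
  obtain ⟨N, hN, hmax⟩ := Set.exists_max_image {N | A.Feasible c N}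
    (fun N => toLex (∑ e ∈ N, A.value e, ∑ e ∈ N, A.prio (A.agent e))) (Set.toFinite _) hne
  refine ⟨N, hN, fun N' hN' => ?_⟩
  have := hmax N' hN'
  simpa [Prod.Lex.le_iff] using this

/-- Neither new matching exceeds its optimum lexicographically, and the combined value and priority
are preserved, so both totals agree on each side. The markets may differ in their ranks, which is
what a misreport changes. -/
theorem optimal_of_sum_eq {B : TieredMarket T V E} (hv : B.value = A.value)
    (ha : B.agent = A.agent) (hp : B.prio = A.prio)
    (hM : A.Optimal c M) (hM' : B.Optimal c' M') (hN : A.Feasible c N) (hN' : B.Feasible c' N')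
    (hsum : ∀ f : E → ℝ, ∑ e ∈ N', f e + ∑ e ∈ N, f e = ∑ e ∈ M', f e + ∑ e ∈ M, f e) :
    A.Optimal c N ∧ ∑ e ∈ N, A.prio (A.agent e) = ∑ e ∈ M, A.prio (A.agent e) := by
  have h1 := hM.2 N hN
  have h2 := hM'.2 N' hN'
  rw [hv, ha, hp] at h2
  have h3 := hsum A.value
  have h4 := hsum fun e => A.prio (A.agent e)
  have h5 : ∑ e ∈ N, A.value e = ∑ e ∈ M, A.value e := by
    rcases h1 with h1 | h1 <;> rcases h2 with h2 | h2 <;> linarith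
  have h6 : ∑ e ∈ N, A.prio (A.agent e) = ∑ e ∈ M, A.prio (A.agent e) := by
    rcases h1 with h1 | h1 <;> rcases h2 with h2 | h2 <;> linarith
  exact ⟨⟨hN, fun X hX => by rw [h5, h6]; exact hM.2 X hX⟩, h6⟩

open scoped Classical in
/-- Exchange between an optimal matching for `c'` and one for `c ≤ c'`. -/
theorem exists_optimal_exchange (hcc : c ≤ c') (hM : A.Optimal c M) (hM' : A.Optimal c' M') {e : E}
    (he : e ∈ M') (hec : A.rank e < c (A.agent e)) (heM : A.label e ∉ M.image A.label) :
    ∃ N S, A.Optimal c N ∧ S.card ≤ 1 ∧ S ⊆ M.image A.label ∧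
      N.image A.label = insert (A.label e) (M.image A.label \ S) ∧
      ∑ e ∈ N, A.prio (A.agent e) = ∑ e ∈ M, A.prio (A.agent e) := by
  obtain ⟨u, hu, N', N, S, k1, k2, k3, k4, k5, k6, k7, k8, k9, k10, k11, k12, k13⟩ :=
    exists_alternating_exchange A.label A.item M'.card M' M {A.label e} ∅ le_rfl
      hM'.1.label_inj hM.1.label_inj hM'.1.item_inj hM.1.item_inj
      (by simpa using Finset.mem_image_of_mem A.label he) (by simpa using heM) (by simp)
  obtain rfl := Finset.mem_singleton.1 hu
  have hrank : ∀ x ∈ M.image A.label, x.2 < c x.1 := by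
    intro x hx
    obtain ⟨y, hy, rfl⟩ := Finset.mem_image.1 hx
    exact hM.1.rank_lt y hy
  have hrank' : ∀ x ∈ M'.image A.label, x.2 < c' x.1 := by
    intro x hx
    obtain ⟨y, hy, rfl⟩ := Finset.mem_image.1 hx
    exact hM'.1.rank_lt y hy
  have hN : A.Feasible c N := ⟨fun x hx => by
    have : A.label x ∈ insert (A.label e) (M.image A.label \ S) :=
      k9 ▸ Finset.mem_image_of_mem _ hx
    rcases Finset.mem_insert.1 this with h | h
    · have h1 : A.agent x = A.agent e := congrArg Prod.fst h
      have h2 : A.rank x = A.rank e := congrArg Prod.snd h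
      rwa [h1, h2]
    · exact hrank _ (Finset.mem_sdiff.1 h).1, k2, k4⟩
  -- The bidder in `S` was revealed in `c`, hence also in `c'`; `c ≤ c'` is needed here.
  have hN' : A.Feasible c' N' := ⟨fun x hx => by
    have : A.label x ∈ (M'.image A.label).erase (A.label e) ∪ S :=
      k10 ▸ Finset.mem_image_of_mem _ hx
    rcases Finset.mem_union.1 this with h | h
    · exact hrank' _ (Finset.mem_of_mem_erase h)
    · exact (hrank _ (k6 h)).trans_le (hcc _), k1, k3⟩
  obtain ⟨h1, h2⟩ := optimal_of_sum_eq rfl rfl rfl hM hM' hN hN' k13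
  exact ⟨N, S, h1, k5, k6, k9, h2⟩

/-- A revealed bidder that is matched later was already matched before. -/
theorem exists_optimal_of_le [Finite E] (hcc : c ≤ c') (hM' : A.Optimal c' M') {e : E} (he : e ∈ M')
    (hec : A.rank e < c (A.agent e)) : ∃ N, A.Optimal c N ∧ ∃ x ∈ N, A.label x = A.label e := by
  classical
  obtain ⟨M, hM⟩ := exists_optimal A c
  by_cases heM : A.label e ∈ M.image A.label
  · exact ⟨M, hM, Finset.mem_image.1 heM⟩
  · obtain ⟨N, S, hN, -, -, h, -⟩ := exists_optimal_exchange hcc hM hM' he hec heM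
    exact ⟨N, hN, Finset.mem_image.1 (h ▸ Finset.mem_insert_self _ _)⟩

/-- All optimal matchings match the same agents. -/
theorem Optimal.exists_agent (hinj : Function.Injective A.prio) (hpos : ∀ t, 0 < A.prio t)
    (hM : A.Optimal c M) (hM' : A.Optimal c M') {e : E} (he : e ∈ M') :
    ∃ x ∈ M, A.agent x = A.agent e := by
  classical
  by_cases heM : A.label e ∈ M.image A.label
  · obtain ⟨x, hx, h⟩ := Finset.mem_image.1 heM
    exact ⟨x, hx, congrArg Prod.fst h⟩
  · obtain ⟨N, S, hN, hS, hSM, h, hsum⟩ :=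
      exists_optimal_exchange le_rfl hM hM' he (hM'.1.rank_lt e he) heM
    have key : ∀ X, A.Optimal c X →
        ∑ e ∈ X, A.prio (A.agent e) = ∑ x ∈ X.image A.label, A.prio x.1 := fun X hX => by
      rw [Finset.sum_image hX.1.label_inj]; rfl
    rw [key N hN, key M hM, h, Finset.sum_insert (by simp [heM]),
      ← Finset.sum_sdiff hSM (f := fun x => A.prio x.1)] at hsum
    -- Equal total priority means that the gained priority equals the lost one. Positivity excludes
    -- an empty `S`, and injectivity makes the displaced bidder one of the same agent.
    have h2 : A.prio (A.agent e) = ∑ x ∈ S, A.prio x.1 := by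
      simp only [label] at hsum ⊢; linarith
    rcases Nat.le_one_iff_eq_zero_or_eq_one.1 hS with h0 | h1
    · rw [Finset.card_eq_zero.1 h0, Finset.sum_empty] at h2
      exact absurd h2 (hpos _).ne'
    · obtain ⟨v, rfl⟩ := Finset.card_eq_one.1 h1
      rw [Finset.sum_singleton] at h2
      obtain ⟨x, hx, rfl⟩ := Finset.mem_image.1 (hSM (Finset.mem_singleton_self v))
      exact ⟨x, hx, (hinj h2).symm⟩

/-- Only the last revealed bidder of an agent is ever matched. -/
def LastMatched (A : TieredMarket T V E) (c : T → ℕ) : Prop :=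
  ∀ N, A.Optimal c N → ∀ e ∈ N, A.rank e + 1 = c (A.agent e)

/-- A matched bidder is either the new one, which is last by construction, or was matched by some
optimal matching before. In the latter case it was last, and its agent is not the waiting agent that
advances, so it remains last. -/
theorem LastMatched.advance [Finite E] (h : A.LastMatched c) (hs : A.Advance len c c') :
    A.LastMatched c' := by
  classical
  obtain ⟨t, -, ht, rfl⟩ := hs
  intro N hN e he
  have hle : c ≤ Function.update c t (c t + 1) := by
    intro s
    by_cases hst : s = t
    · subst hst; simp
    · simp [hst]
  by_cases hec : A.rank e < c (A.agent e)
  · obtain ⟨X, hX, x, hx, hxe⟩ := exists_optimal_of_le hle hN he hec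
    have h1 : A.agent x = A.agent e := congrArg Prod.fst hxe
    have h2 : A.rank x = A.rank e := congrArg Prod.snd hxe
    have := h X hX x hx
    rw [Function.update_of_ne (h1 ▸ ht X hX x hx), ← h1, ← h2, this]
  · have := hN.1.rank_lt e he
    by_cases het : A.agent e = t
    · subst het; simp at this ⊢; omega
    · rw [Function.update_of_ne het] at this; exact absurd this hec

theorem Reachable.lastMatched [Finite E] (h : A.Reachable len c) : A.LastMatched c := by
  induction h with
  | refl => exact fun N hN e he => absurd (hN.1.rank_lt e he) (by simp)
  | tail _ hs ih => exact ih.advance hs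

theorem Reachable.le_len (h : A.Reachable len c) (t : T) : c t ≤ len t := by
  classical
  induction h with
  | refl => simp
  | tail _ hs ih =>
    obtain ⟨s, hs, -, rfl⟩ := hs
    by_cases hst : t = s
    · subst hst; rw [Function.update_self]; exact hs
    · rw [Function.update_of_ne hst]; exact ih

theorem LastMatched.agent_injOn (h : A.LastMatched c) (hN : A.Optimal c N) :
    Set.InjOn A.agent N := by
  intro x hx y hy hxy
  refine hN.1.label_inj hx hy (Prod.ext hxy ?_)
  have h1 := h N hN x hx
  have h2 := h N hN y hy
  rw [hxy, ← h2] at h1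
  exact Nat.succ_injective h1

/-- A waiting agent keeps waiting when other agents advance. -/
theorem Waiting.mono [Finite E] (hcc : c ≤ c') {t : T} (ht : c' t ≤ c t) (h : A.Waiting c t) :
    A.Waiting c' t := by
  rintro N hN e he rfl
  obtain ⟨X, hX, x, hx, hxe⟩ :=
    exists_optimal_of_le hcc hN he ((hN.1.rank_lt e he).trans_le ht)
  exact h X hX x hx (congrArg Prod.fst hxe)

/-- No bidder can be revealed any more. -/
def Final (A : TieredMarket T V E) (len c : T → ℕ) : Prop :=
  ∀ t, c t < len t → ¬ A.Waiting c t

/-- Consider the first step overtaking `c'`, at agent `s`. Before it the state lies below `c'` and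
agrees with it at `s`, so `s`, waiting there, also waits in `c'`, contrary to finality. Applied both
ways, this gives uniqueness of the reachable final state. -/
theorem Reachable.le_of_final [Finite E] (h : A.Reachable len c) (hc' : A.Final len c') :
    c ≤ c' := by
  classical
  induction h with
  | refl => exact fun _ => Nat.zero_le _
  | tail _ hs ih =>
    obtain ⟨t, h1, h2, rfl⟩ := hs
    intro s
    by_cases hst : s = t
    · subst hst
      rw [Function.update_self]
      by_contra! hlt
      have : c' s ≤ _ := Nat.lt_succ_iff.1 hlt
      exact hc' s (this.trans_lt h1) (h2.mono ih this)
    · rw [Function.update_of_ne hst]; exact ih s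

/-- The last reveal of a bidder of an agent in `R`. -/
theorem Reachable.exists_last_advance (h : A.Reachable len c) (R : Set T) :
    (∀ t ∈ R, c t = 0) ∨ ∃ q, A.Reachable len q ∧ q ≤ c ∧ ∃ s ∈ R, A.Waiting q s ∧ q s + 1 = c s ∧
      ∀ t ∈ R, t ≠ s → q t = c t := by
  classical
  induction h with
  | refl => exact Or.inl fun _ _ => rfl
  | @tail c d hc hs ih =>
    obtain ⟨s, h1, h2, rfl⟩ := hs
    have hle : c ≤ Function.update c s (c s + 1) := by
      intro t
      by_cases hst : t = s
      · subst hst; simp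
      · simp [hst]
    by_cases hsR : s ∈ R
    · exact Or.inr ⟨c, hc, hle, s, hsR, h2, by simp, fun t _ ht => by simp [ht]⟩
    · have hne : ∀ t ∈ R, t ≠ s := fun t ht h => hsR (h ▸ ht)
      rcases ih with ih | ⟨q, hq, hqc, s', hs', hw, he, hR⟩
      · exact Or.inl fun t ht => by simp [hne t ht, ih t ht]
      · refine Or.inr ⟨q, hq, hqc.trans hle, s', hs', hw, by simp [hne s' hs', he], fun t ht hts => ?_⟩
        rw [Function.update_of_ne (hne t ht), hR t ht hts]

/-- An agent `p` does not gain by changing the ranks of its own edges. -/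
theorem le_rank_of_misreport [Finite E] [Finite T] {B : TieredMarket T V E}
    {len' : T → ℕ} (p : T)
    (hagent : B.agent = A.agent) (hitem : B.item = A.item) (hvalue : B.value = A.value)
    (hprio : B.prio = A.prio) (hrank : ∀ e, A.agent e ≠ p → B.rank e = A.rank e)
    (hc : A.Reachable len c) (hc' : B.Reachable len' c') (hM' : B.Optimal c' M')
    (hall : ∀ t, ∃ e ∈ M', A.agent e = t) {e : E} (he : e ∈ M') (hep : A.agent e = p) :
    c p ≤ A.rank e + 1 := by
  classical
  by_contra! hlt
  have := Fintype.ofFinite T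
  have hM'a : Set.InjOn A.agent M' := hagent ▸ hc'.lastMatched.agent_injOn hM'
  have hM'l : Set.InjOn A.label M' := fun x hx y hy h => hM'a hx hy (congrArg Prod.fst h)
  choose f hfM hf using hall
  have hfe : ∀ x ∈ M', x = f (A.agent x) := fun x hx => hM'a hx (hfM _) (hf _).symm
  -- The agents for which `M'` is better, in true ranks, than the tier `c t - 1` reached by the
  -- truthful run.
  let R : Finset T := Finset.univ.filter fun t => A.rank (f t) + 1 < c t
  have hR : ∀ t, t ∈ R ↔ A.rank (f t) + 1 < c t := fun t => by simp [R]
  have hpR : p ∈ R := by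
    rw [hR, ← hep, ← hfe e he, hep]; exact hlt
  -- In state `q`, agent `s` is waiting and the other agents of `R` have all their bidders revealed
  -- already. The bidder of `f t` is revealed for every `t` in `R`, as it comes strictly before the
  -- last bidder of `t` in `c`.
  rcases hc.exists_last_advance (R : Set T) with h0 | ⟨q, hq, hqc, s, hs, hw, hqs, hqR⟩
  · have := h0 p hpR
    omega
  have hs : s ∈ R := hs
  have hqR : ∀ t ∈ R, t ≠ s → q t = c t := hqR
  obtain ⟨M, hM⟩ := exists_optimal A q
  have hlast := hq.lastMatched
  have hfq : ∀ t ∈ R, A.rank (f t) < q t := by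
    intro t ht
    have h1 := (hR t).1 ht
    by_cases hts : t = s
    · subst hts; omega
    · rw [hqR t ht hts]; omega
  -- the bidder of `f t` is not matched in an optimal matching for `q`
  have hnot : ∀ t ∈ R, ∀ X, A.Optimal q X → ∀ x ∈ X, A.label x ≠ A.label (f t) := by
    intro t ht X hX x hx hxt
    have h1 : A.agent x = t := (congrArg Prod.fst hxt).trans (hf t)
    have h2 : A.rank x = A.rank (f t) := congrArg Prod.snd hxt
    have h3 := hlast X hX x hx
    by_cases hts : t = s
    · exact hw X hX x hx (h1.trans hts)
    · have := (hR t).1 ht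
      rw [h1, h2, hqR t ht hts] at h3
      omega
  -- The forbidden endpoints are the last bidders of `R` without `s`, the only bidders of `R` that
  -- `M` can match. They are one fewer than the starting points.
  have hcard : ((R.erase s).image fun t => (t, c t - 1)).card <
      (R.image fun t => A.label (f t)).card := by
    refine Finset.card_image_le.trans_lt ?_
    rw [Finset.card_image_of_injective, Finset.card_erase_of_mem hs]
    · have := Finset.card_pos.2 ⟨s, hs⟩
      omega
    · intro x y hxy
      have : A.agent (f x) = A.agent (f y) := congrArg Prod.fst hxy
      rwa [hf, hf] at this
  obtain ⟨u, hu, N', N, S, k1, k2, k3, k4, -, k6, -, k8, k9, k10, k11, -, k13⟩ :=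
    exists_alternating_exchange A.label A.item M'.card M' M (R.image fun t => A.label (f t))
      ((R.erase s).image fun t => (t, c t - 1)) le_rfl hM'l hM.1.label_inj
      (hitem ▸ hM'.1.item_inj) hM.1.item_inj
      (by
        intro x hx
        obtain ⟨t, -, rfl⟩ := Finset.mem_image.1 hx
        exact Finset.mem_image_of_mem _ (hfM t))
      (by
        rw [Finset.disjoint_left]
        intro x hx hx'
        obtain ⟨t, ht, rfl⟩ := Finset.mem_image.1 hx
        obtain ⟨y, hy, hyt⟩ := Finset.mem_image.1 hx'
        exact hnot t ht M hM y hy hyt)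
      hcard
  obtain ⟨τ, hτ, rfl⟩ := Finset.mem_image.1 hu
  have hN : A.Feasible q N := ⟨fun x hx => by
    have : A.label x ∈ insert (A.label (f τ)) (M.image A.label \ S) :=
      k9 ▸ Finset.mem_image_of_mem _ hx
    rcases Finset.mem_insert.1 this with h | h
    · have h1 : A.agent x = τ := (congrArg Prod.fst h).trans (hf τ)
      have h2 : A.rank x = A.rank (f τ) := congrArg Prod.snd h
      rw [h1, h2]
      exact hfq τ hτ
    · obtain ⟨y, hy, hyx⟩ := Finset.mem_image.1 (Finset.mem_sdiff.1 h).1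
      rw [← show A.agent y = A.agent x from congrArg Prod.fst hyx,
        ← show A.rank y = A.rank x from congrArg Prod.snd hyx]
      exact hM.1.rank_lt y hy, k2, k4⟩
  -- As forbidden endpoints are avoided, the displaced bidder belongs to an agent outside `R`.
  have hS : ∀ y ∈ M, A.label y ∈ S → A.agent y ∉ R := by
    intro y hy hyS hyR
    have hys : A.agent y ≠ s := hw M hM y hy
    refine Finset.disjoint_left.1 k8 hyS (Finset.mem_image.2
      ⟨A.agent y, Finset.mem_erase.2 ⟨hys, hyR⟩, Prod.ext rfl ?_⟩)
    have h1 := hlast M hM y hy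
    rw [hqR _ hyR hys] at h1
    change c (A.agent y) - 1 = A.rank y
    omega
  have hlab : ∀ x ∈ N', (∃ y ∈ M', A.label y = A.label x) ∨
      (A.agent x ∉ R ∧ ∃ y ∈ M, A.label y = A.label x) := by
    intro x hx
    have : A.label x ∈ (M'.image A.label).erase (A.label (f τ)) ∪ S :=
      k10 ▸ Finset.mem_image_of_mem _ hx
    rcases Finset.mem_union.1 this with h | h
    · exact Or.inl (Finset.mem_image.1 (Finset.mem_of_mem_erase h))
    · obtain ⟨y, hy, hyx⟩ := Finset.mem_image.1 (k6 h)
      refine Or.inr ⟨?_, y, hy, hyx⟩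
      rw [← show A.agent y = A.agent x from congrArg Prod.fst hyx]
      exact hS y hy (hyx ▸ h)
  -- the only possible edge of `p` is the one in `M'`
  have hp : ∀ x ∈ N', A.agent x = p → x = f p := by
    intro x hx hxp
    rcases hlab x hx with ⟨y, hy, hyx⟩ | ⟨h, -⟩
    · have hya : A.agent y = p := (congrArg Prod.fst hyx).trans hxp
      have hyf : y = f p := hya ▸ hfe y hy
      rcases Finset.mem_union.1 (k11 hx) with h | h
      · exact hxp ▸ hfe x h
      · exact absurd (hyf ▸ hyx.symm) (hnot p hpR M hM x h)
    · exact absurd (hxp ▸ hpR) h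
  -- Ranks in `A` and `B` agree except on edges of `p`, whose only possible edge in `N'` is the one
  -- in `M'`. An agent `t` outside `R` has `c t ≤ A.rank (f t) + 1 ≤ c' t`, so what is revealed for
  -- it in `q` is also revealed in `c'`.
  have hN' : B.Feasible c' N' := by
    refine ⟨fun x hx => ?_, fun x hx y hy hxy => ?_, hitem ▸ k3⟩
    · rw [hagent]
      by_cases hxp : A.agent x = p
      · have := hM'.1.rank_lt _ (hfM p)
        rwa [hagent, ← hp x hx hxp] at this
      · rw [hrank x hxp]
        rcases hlab x hx with ⟨y, hy, hyx⟩ | ⟨h, y, hy, hyx⟩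
        · have h1 : A.agent y = A.agent x := congrArg Prod.fst hyx
          have h2 : A.rank y = A.rank x := congrArg Prod.snd hyx
          have := hM'.1.rank_lt y hy
          rwa [hagent, hrank y (h1 ▸ hxp), h1, h2] at this
        · have h1 : A.agent y = A.agent x := congrArg Prod.fst hyx
          have h2 : A.rank y = A.rank x := congrArg Prod.snd hyx
          have h3 := hM.1.rank_lt y hy
          rw [h1, h2] at h3
          have h4 : q (A.agent x) ≤ c (A.agent x) := hqc _
          rw [hR] at h
          have h5 := hM'.1.rank_lt _ (hfM (A.agent x))
          rw [hagent, hf, hrank _ (by rwa [hf])] at h5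
          omega
    · have h1 : A.agent x = A.agent y := by
        rw [← hagent]; exact congrArg Prod.fst hxy
      by_cases hxp : A.agent x = p
      · rw [hp x hx hxp, hp y hy (h1 ▸ hxp)]
      · have h2 : B.rank x = B.rank y := congrArg Prod.snd hxy
        rw [hrank x hxp, hrank y (h1 ▸ hxp)] at h2
        exact k1 hx hy (Prod.ext h1 h2)
  have hopt := (optimal_of_sum_eq hvalue hagent hprio hM hM' hN hN' k13).1
  obtain ⟨x, hx, hxt⟩ := Finset.mem_image.1 (k9 ▸ Finset.mem_insert_self _ _)
  exact hnot τ hτ N hopt x hx hxt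

end TieredMarket

/-! ### Tier numbers represent weak preferences -/

namespace WeakPref

variable {α : Type*} [Fintype α]

theorem mem_cls_self (r : WeakPref α) (x : α) : x ∈ r.cls x := by
  classical
  have := r.total x x
  exact Finset.mem_filter.2 ⟨Finset.mem_univ _, by tauto⟩

theorem tier_lt_numTiers (r : WeakPref α) (x : α) : r.tier x < r.numTiers := by
  classical
  refine Finset.card_lt_card (Finset.ssubset_iff_subset_ne.2
    ⟨Finset.image_subset_image (Finset.subset_univ _), fun h => ?_⟩)
  have hx : r.cls x ∈ Finset.univ.image fun x => r.cls x := by simp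
  rw [← h] at hx
  obtain ⟨y, hy, hyx⟩ := Finset.mem_image.1 hx
  have h1 : x ∈ r.cls y := hyx ▸ r.mem_cls_self x
  have h2 : r.gt y x := (Finset.mem_filter.1 hy).2
  have h3 : r.indiff y x := (Finset.mem_filter.1 h1).2
  exact h2.2 h3.2

theorem tier_le_tier {r : WeakPref α} {x y : α} (h : r.ge x y) : r.tier x ≤ r.tier y := by
  classical
  refine Finset.card_le_card (Finset.image_subset_image fun z hz => ?_)
  have hz : r.gt z x := (Finset.mem_filter.1 hz).2
  exact Finset.mem_filter.2 ⟨Finset.mem_univ _, r.trans _ _ _ hz.1 h,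
    fun h' => hz.2 (r.trans _ _ _ h h')⟩

theorem tier_lt_tier {r : WeakPref α} {x y : α} (h : r.gt x y) : r.tier x < r.tier y := by
  classical
  refine Finset.card_lt_card (Finset.ssubset_iff_subset_ne.2
    ⟨Finset.image_subset_image fun z hz => ?_, fun he => ?_⟩)
  · have hz : r.gt z x := (Finset.mem_filter.1 hz).2
    exact Finset.mem_filter.2 ⟨Finset.mem_univ _, r.trans _ _ _ hz.1 h.1,
      fun h' => hz.2 (r.trans _ _ _ h.1 h')⟩
  · have hx : r.cls x ∈ (Finset.univ.filter fun z => r.gt z y).image fun z => r.cls z :=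
      Finset.mem_image_of_mem _ (Finset.mem_filter.2 ⟨Finset.mem_univ _, h⟩)
    rw [← he] at hx
    obtain ⟨z, hz, hzx⟩ := Finset.mem_image.1 hx
    have h1 : x ∈ r.cls z := hzx ▸ r.mem_cls_self x
    have h2 : r.gt z x := (Finset.mem_filter.1 hz).2
    have h3 : r.indiff z x := (Finset.mem_filter.1 h1).2
    exact h2.2 h3.2

theorem ge_iff_tier_le {r : WeakPref α} {x y : α} : r.ge x y ↔ r.tier x ≤ r.tier y := by
  refine ⟨tier_le_tier, fun h => ?_⟩
  by_contra hxy
  exact absurd (tier_lt_tier ⟨(r.total x y).resolve_left hxy, hxy⟩) (not_lt.2 h)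

end WeakPref

/-! ### Greedy matchings as lexicographic maxima -/

namespace UAP

variable {ι V : Type*}

theorem mem_matched {M : Finset (ι × V)} {u : ι} : u ∈ matched M ↔ ∃ e ∈ M, e.1 = u := by
  classical
  simp [matched]

theorem sum_matched {M : Finset (ι × V)} (hM : Set.InjOn Prod.fst (M : Set (ι × V)))
    (f : ι → ℝ) : ∑ u ∈ matched M, f u = ∑ e ∈ M, f e.1 := by
  classical
  exact Finset.sum_image hM

theorem Indep.exists_isBasis {A : UAP ι V} {S : Finset ι} (hS : A.Indep S) :
    ∃ B, A.IsBasis B ∧ S ⊆ B := by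
  classical
  have hfin : {B | A.Indep B}.Finite :=
    A.bidders.powerset.finite_toSet.subset fun B hB => Finset.mem_powerset.2 hB.1
  obtain ⟨B, hSB, hB⟩ := hfin.exists_le_maximal (show S ∈ {B | A.Indep B} from hS)
  exact ⟨B, ⟨hB.1, fun S' hS' h => le_antisymm (hB.2 hS' h) h⟩, hSB⟩

theorem IsMWM.indep {A : UAP ι V} {M : Finset (ι × V)} (hM : A.IsMWM M) :
    A.Indep (matched M) := by
  classical
  refine ⟨fun u hu => ?_, M, hM, subset_rfl⟩
  obtain ⟨e, he, rfl⟩ := Finset.mem_image.1 hu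
  exact hM.1.bidder_mem e he

/-- With positive priorities, greedy maximum-weight matchings are the maximum-weight matchings of
maximum total priority. -/
theorem isGreedyMWM_iff {A : UAP ι V} (hpos : ∀ u, 0 < A.priority u) {M : Finset (ι × V)} :
    A.IsGreedyMWM M ↔ A.IsMWM M ∧ ∀ M', A.IsMWM M' →
      ∑ u ∈ matched M', A.priority u ≤ ∑ u ∈ matched M, A.priority u := by
  classical
  have hmono : ∀ {S S' : Finset ι}, S ⊆ S' → ∑ u ∈ S, A.priority u ≤ ∑ u ∈ S', A.priority u :=
    fun h => Finset.sum_le_sum_of_subset_of_nonneg h fun _ _ _ => (hpos _).le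
  constructor
  · rintro ⟨h1, -, h3⟩
    refine ⟨h1, fun M' hM' => ?_⟩
    obtain ⟨B, hB, hMB⟩ := hM'.indep.exists_isBasis
    exact (hmono hMB).trans (h3 B hB)
  · rintro ⟨h1, h2⟩
    refine ⟨h1, ⟨h1.indep, fun S' hS' hsub => ?_⟩, fun S hS => ?_⟩
    · obtain ⟨-, M', hM', hSM'⟩ := hS'
      by_contra hne
      have hlt : ∑ u ∈ matched M, A.priority u < ∑ u ∈ S', A.priority u := by
        obtain ⟨x, hx, hxM⟩ := Finset.exists_of_ssubset (hsub.ssubset_of_ne (Ne.symm hne))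
        exact Finset.sum_lt_sum_of_subset hsub hx hxM (hpos x) fun _ _ _ => (hpos _).le
      exact absurd (h2 M' hM') (not_le.2 (hlt.trans_le (hmono hSM')))
    · obtain ⟨-, M', hM', hSM'⟩ := hS.1
      exact (hmono hSM').trans (h2 M' hM')

end UAP

/-! ### Translation between the auction and the market -/

namespace SMIW

theorem item_injective {M W : Type*} {i : M} : Function.Injective (item i : Option W → W ⊕ M) := by
  intro x y h
  cases x <;> cases y <;> simp_all [item]

theorem bid_item {M W : Type*} [Fintype W] (I : SMIW M W) (ψ : W → Option M → ℝ)
    (e : M × Option W) :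
    I.bid ψ e.1 ((I.manPref e.1).tier e.2) (item e.1 e.2) =
      some (e.2.elim 0 fun w => ψ w (some e.1)) := by
  obtain ⟨i, _ | w⟩ := e <;> simp [item, bid]

theorem exists_of_bid_isSome {M W : Type*} [Fintype W] (I : SMIW M W)
    (ψ : W → Option M → ℝ) {i : M} {k : ℕ} {v : W ⊕ M} (h : (I.bid ψ i k v).isSome) :
    ∃ x, item i x = v ∧ (I.manPref i).tier x = k := by
  classical
  rcases v with w | j
  · refine ⟨some w, rfl, ?_⟩
    by_contra hne
    simp [bid, hne] at h
  · by_cases hc : j = i ∧ (I.manPref i).tier none = k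
    · exact ⟨none, by rw [hc.1]; rfl, hc.2⟩
    · simp [bid, hc] at h

variable {M W : Type*} [Fintype M] [Fintype W]

/-- The market whose edges are pairs of a man and an alternative (a woman, or `none` for his dummy
item); the rank of an edge is the tier of the alternative. -/
noncomputable def market (I : SMIW M W) (idx : M ≃ Fin (Fintype.card M)) (ψ : W → Option M → ℝ) :
    TieredMarket M (W ⊕ M) (M × Option W) where
  agent := Prod.fst
  item e := item e.1 e.2
  rank e := (I.manPref e.1).tier e.2
  value e := e.2.elim 0 fun w => ψ w (some e.1)
  prio i := ((idx i : ℕ) : ℝ) + 1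

variable (I : SMIW M W) (idx : M ≃ Fin (Fintype.card M)) (ψ : W → Option M → ℝ)

noncomputable abbrev tiers (i : M) : ℕ := (I.manPref i).numTiers

theorem market_prio_pos (i : M) : 0 < (I.market idx ψ).prio i := by
  simp only [market]; positivity

theorem market_prio_injective : Function.Injective (I.market idx ψ).prio :=
  (I.toIUAP idx ψ).priority_injective

/-- The bid that corresponds to a pair of a man and an alternative. -/
noncomputable def edge : M × Option W ↪ (I.toIUAP idx ψ).Bidder × (W ⊕ M) where
  toFun e := (⟨e.1, (I.manPref e.1).tier e.2, (I.manPref e.1).tier_lt_numTiers e.2⟩, item e.1 e.2)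
  inj' := by
    rintro ⟨i, x⟩ ⟨j, y⟩ h
    simp only [Prod.mk.injEq, Sigma.mk.injEq] at h
    obtain ⟨⟨rfl, -⟩, h⟩ := h
    rw [item_injective h]

/-- The bidder of a tier bids only on items of alternatives in that tier, so `edge` reaches every
bid and auction matchings can be pulled back to the market. -/
theorem exists_edge {u : (I.toIUAP idx ψ).Bidder} {v : W ⊕ M}
    (h : ((I.toIUAP idx ψ).bid u.1 u.2 v).isSome) : ∃ e, I.edge idx ψ e = (u, v) := by
  obtain ⟨x, rfl, h2⟩ := I.exists_of_bid_isSome ψ h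
  refine ⟨(u.1, x), ?_⟩
  exact Prod.ext (Sigma.ext rfl (heq_of_eq (Fin.ext h2))) rfl

/-- `U` consists of the first `c i` bidders of every man `i`. -/
def Represents {I : SMIW M W} {idx : M ≃ Fin (Fintype.card M)} {ψ : W → Option M → ℝ}
    (U : Finset (I.toIUAP idx ψ).Bidder) (c : M → ℕ) : Prop :=
  ∀ u, u ∈ U ↔ (u.2 : ℕ) < c u.1

variable {I idx ψ} {U U' : Finset (I.toIUAP idx ψ).Bidder} {c : M → ℕ} {N : Finset (M × Option W)}
  {M₀ : Finset ((I.toIUAP idx ψ).Bidder × (W ⊕ M))}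

theorem label_eq_iff {x y : M × Option W} : (I.edge idx ψ x).1 = (I.edge idx ψ y).1 ↔
    (I.market idx ψ).label x = (I.market idx ψ).label y := by
  obtain ⟨i, x⟩ := x
  obtain ⟨j, y⟩ := y
  constructor
  · intro h
    obtain ⟨rfl, h2⟩ := Sigma.mk.inj h
    exact Prod.ext rfl (congrArg Fin.val (eq_of_heq h2))
  · intro h
    obtain ⟨rfl, h2⟩ := Prod.mk.inj h
    exact Sigma.ext rfl (heq_of_eq (Fin.ext h2))

theorem isMatching_map (hU : Represents U c) :
    ((I.toIUAP idx ψ).toUAP U).IsMatching (N.map (I.edge idx ψ)) ↔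
      (I.market idx ψ).Feasible c N := by
  constructor
  · intro h
    refine ⟨fun e he => ?_, fun x hx y hy hxy => ?_, fun x hx y hy hxy => ?_⟩
    · exact (hU _).1 (h.bidder_mem _ (Finset.mem_map_of_mem _ he))
    · exact (I.edge idx ψ).injective (h.bidder_inj _ (Finset.mem_map_of_mem _ hx) _
        (Finset.mem_map_of_mem _ hy) (label_eq_iff.2 hxy))
    · exact (I.edge idx ψ).injective (h.item_inj _ (Finset.mem_map_of_mem _ hx) _
        (Finset.mem_map_of_mem _ hy) hxy)
  · intro h
    refine ⟨?_, ?_, ?_, ?_⟩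
    · simp only [Finset.mem_map, forall_exists_index, and_imp, forall_apply_eq_imp_iff₂]
      exact fun e he => (hU _).2 (h.rank_lt e he)
    · simp only [Finset.mem_map, forall_exists_index, and_imp, forall_apply_eq_imp_iff₂]
      intro e _
      exact Option.isSome_iff_exists.2 ⟨_, I.bid_item ψ e⟩
    · simp only [Finset.mem_map, forall_exists_index, and_imp, forall_apply_eq_imp_iff₂]
      exact fun x hx y hy hxy => congrArg _ (h.label_inj hx hy (label_eq_iff.1 hxy))
    · simp only [Finset.mem_map, forall_exists_index, and_imp, forall_apply_eq_imp_iff₂]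
      exact fun x hx y hy hxy => congrArg _ (h.item_inj hx hy hxy)

theorem exists_eq_map (h : ((I.toIUAP idx ψ).toUAP U).IsMatching M₀) :
    ∃ N : Finset (M × Option W), M₀ = N.map (I.edge idx ψ) := by
  classical
  refine ⟨Finset.univ.filter fun e => I.edge idx ψ e ∈ M₀, ?_⟩
  ext e
  simp only [Finset.mem_map, Finset.mem_filter, Finset.mem_univ, true_and]
  constructor
  · intro he
    obtain ⟨x, hx⟩ := I.exists_edge idx ψ (h.edge e he)
    exact ⟨x, hx ▸ he, hx⟩
  · rintro ⟨x, hx, rfl⟩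
    exact hx

theorem weight_map : ((I.toIUAP idx ψ).toUAP U).weight (N.map (I.edge idx ψ)) =
    ∑ e ∈ N, (I.market idx ψ).value e := by
  rw [UAP.weight, Finset.sum_map]
  refine Finset.sum_congr rfl fun e _ => ?_
  exact congrArg (Option.getD · 0) (I.bid_item ψ e)

theorem sum_priority_map (hN : (I.market idx ψ).Feasible c N) :
    ∑ u ∈ UAP.matched (N.map (I.edge idx ψ)), ((I.toIUAP idx ψ).toUAP U).priority u =
      ∑ e ∈ N, (I.market idx ψ).prio ((I.market idx ψ).agent e) := by
  rw [UAP.sum_matched, Finset.sum_map]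
  · rfl
  · simp only [Set.InjOn, Finset.coe_map, Set.mem_image, Finset.mem_coe, forall_exists_index,
      and_imp, forall_apply_eq_imp_iff₂]
    exact fun x hx y hy hxy => congrArg _ (hN.label_inj hx hy (label_eq_iff.1 hxy))

theorem isGreedyMWM_map (hU : Represents U c) :
    ((I.toIUAP idx ψ).toUAP U).IsGreedyMWM (N.map (I.edge idx ψ)) ↔
      (I.market idx ψ).Optimal c N := by
  rw [UAP.isGreedyMWM_iff fun u => I.market_prio_pos idx ψ u.1]
  constructor
  · rintro ⟨⟨h1, h2⟩, h3⟩
    have hN := (isMatching_map hU).1 h1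
    refine ⟨hN, fun N' hN' => ?_⟩
    have h4 := h2 _ ((isMatching_map hU).2 hN')
    rw [weight_map, weight_map] at h4
    refine h4.lt_or_eq.imp id fun h5 => ⟨h5, ?_⟩
    have h6 := h3 (N'.map (I.edge idx ψ)) ⟨(isMatching_map hU).2 hN', fun X hX => by
      rw [weight_map, h5, ← weight_map]; exact h2 X hX⟩
    rwa [sum_priority_map hN, sum_priority_map hN'] at h6
  · rintro ⟨hN, h⟩
    have hle : ∀ X, ((I.toIUAP idx ψ).toUAP U).IsMatching X →
        ((I.toIUAP idx ψ).toUAP U).weight X ≤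
          ((I.toIUAP idx ψ).toUAP U).weight (N.map (I.edge idx ψ)) := by
      intro X hX
      obtain ⟨N', rfl⟩ := exists_eq_map hX
      rw [weight_map, weight_map]
      exact (h N' ((isMatching_map hU).1 hX)).elim le_of_lt fun h => h.1.le
    refine ⟨⟨(isMatching_map hU).2 hN, hle⟩, fun X hX => ?_⟩
    obtain ⟨N', rfl⟩ := exists_eq_map hX.1
    have hN' := (isMatching_map hU).1 hX.1
    have h1 := hX.2 _ ((isMatching_map hU).2 hN)
    rw [weight_map, weight_map] at h1
    rw [sum_priority_map hN, sum_priority_map hN']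
    exact (h N' hN').elim (fun h2 => absurd h1 (not_le.2 h2)) fun h2 => h2.2

theorem isGreedyCount_zero_iff (hU : Represents U c) (i : M) :
    ((I.toIUAP idx ψ).toUAP U).IsGreedyCount ((I.toIUAP idx ψ).priority i) 0 ↔
      (I.market idx ψ).Waiting c i := by
  classical
  constructor
  · intro h N hN e he hei
    have h1 := h _ ((isGreedyMWM_map hU).2 hN)
    rw [Finset.card_eq_zero, Finset.filter_eq_empty_iff] at h1
    refine h1 (x := (I.edge idx ψ e).1)
      (UAP.mem_matched.2 ⟨_, Finset.mem_map_of_mem _ he, rfl⟩) ?_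
    exact congrArg (I.toIUAP idx ψ).priority hei
  · intro h X hX
    obtain ⟨N, rfl⟩ := exists_eq_map hX.1.1
    rw [Finset.card_eq_zero, Finset.filter_eq_empty_iff]
    intro u hu hui
    obtain ⟨e', he', rfl⟩ := UAP.mem_matched.1 hu
    obtain ⟨e, he, rfl⟩ := Finset.mem_map.1 he'
    exact h N ((isGreedyMWM_map hU).1 hX) e he ((I.toIUAP idx ψ).priority_injective hui)

/-- Identifies the count in `Ready` with `c i`. The bound `hc` matters because a man has no bidders
beyond his number of tiers. -/
theorem Represents.card_filter (hU : Represents U c) (hc : ∀ i, c i ≤ I.tiers i)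
    (i : M) [DecidablePred fun u : (I.toIUAP idx ψ).Bidder => u.1 = i] :
    (U.filter fun u => u.1 = i).card = c i := by
  classical
  rw [← Finset.card_range (c i)]
  refine Finset.card_bij (fun u _ => (u.2 : ℕ)) ?_ ?_ ?_
  · intro u hu
    rw [Finset.mem_filter] at hu
    rw [Finset.mem_range, ← hu.2]
    exact (hU u).1 hu.1
  · rintro ⟨j, a⟩ h1 ⟨k, b⟩ h2 hab
    obtain rfl : j = i := (Finset.mem_filter.1 h1).2
    obtain rfl : k = j := (Finset.mem_filter.1 h2).2
    congr 1
    exact Fin.ext hab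
  · intro k hk
    rw [Finset.mem_range] at hk
    exact ⟨⟨i, k, hk.trans_le (hc i)⟩, Finset.mem_filter.2 ⟨(hU _).2 hk, rfl⟩, rfl⟩

theorem ready_iff (hU : Represents U c) (hc : ∀ i, c i ≤ I.tiers i)
    (u : (I.toIUAP idx ψ).Bidder) :
    (I.toIUAP idx ψ).Ready U u ↔ (I.market idx ψ).Waiting c u.1 ∧ (u.2 : ℕ) = c u.1 := by
  rw [IUAP.Ready, isGreedyCount_zero_iff hU, hU.card_filter hc]

theorem Represents.insert [DecidableEq M] [DecidableEq (I.toIUAP idx ψ).Bidder]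
    (hU : Represents U c) {u : (I.toIUAP idx ψ).Bidder} (hu : (u.2 : ℕ) = c u.1) :
    Represents (insert u U) (Function.update c u.1 (c u.1 + 1)) := by
  intro v
  rw [Finset.mem_insert, hU]
  by_cases hv : v.1 = u.1
  · obtain ⟨i, a⟩ := u
    obtain ⟨j, b⟩ := v
    obtain rfl : j = i := hv
    have hu : (a : ℕ) = c j := hu
    rw [Function.update_self, Nat.lt_succ_iff_lt_or_eq, or_comm, ← hu]
    refine or_congr_right ⟨fun h => ?_, fun h => Sigma.ext rfl (heq_of_eq (Fin.ext h))⟩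
    rw [h]
  · rw [Function.update_of_ne hv]
    have : v ≠ u := fun h => hv (h ▸ rfl)
    tauto

theorem exists_reachable_of_reveals (h : Relation.ReflTransGen (I.toIUAP idx ψ).Step ∅ U) :
    ∃ c, (I.market idx ψ).Reachable I.tiers c ∧ Represents U c := by
  classical
  induction h with
  | refl => exact ⟨_, Relation.ReflTransGen.refl, fun u => by simp⟩
  | tail _ hs ih =>
    obtain ⟨c, hc, hU⟩ := ih
    obtain ⟨u, hu, rfl⟩ := hs
    obtain ⟨h1, h2⟩ := (ready_iff hU hc.le_len u).1 hu
    have := hU.insert h2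
    refine ⟨_, hc.tail ⟨u.1, h2 ▸ u.2.2, h1, rfl⟩, ?_⟩
    convert this

theorem final_iff (hU : Represents U c) (hc : ∀ i, c i ≤ I.tiers i) :
    (∀ u, ¬ (I.toIUAP idx ψ).Ready U u) ↔ (I.market idx ψ).Final I.tiers c := by
  constructor
  · intro h i hi hw
    exact h ⟨i, c i, hi⟩ ((ready_iff hU hc _).2 ⟨hw, rfl⟩)
  · intro h u hu
    obtain ⟨h1, h2⟩ := (ready_iff hU hc u).1 hu
    exact h u.1 (h2 ▸ u.2.2) h1

theorem IsFinal.exists_reachable (h : (I.toIUAP idx ψ).IsFinal U) :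
    ∃ c, (I.market idx ψ).Reachable I.tiers c ∧ (I.market idx ψ).Final I.tiers c ∧
      Represents U c := by
  obtain ⟨c, hc, hU⟩ := exists_reachable_of_reveals h.1
  exact ⟨c, hc, (final_iff hU hc.le_len).1 h.2, hU⟩

theorem card_of_step (h : Relation.ReflTransGen (I.toIUAP idx ψ).Step ∅ U)
    (hs : (I.toIUAP idx ψ).Step U U') : U'.card = U.card + 1 := by
  classical
  obtain ⟨c, hc, hU⟩ := exists_reachable_of_reveals h
  obtain ⟨u, hu, rfl⟩ := hs
  obtain ⟨h1, h2⟩ := (ready_iff hU hc.le_len u).1 hu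
  have : u ∉ U := by rw [hU, h2]; exact lt_irrefl _
  convert Finset.card_insert_of_notMem this

variable (I idx ψ) in
theorem terminates : (I.toIUAP idx ψ).Terminates := by
  classical
  rintro ⟨f, h0, hf⟩
  have hr : ∀ n, Relation.ReflTransGen (I.toIUAP idx ψ).Step ∅ (f n) := by
    intro n
    induction n with
    | zero => rw [h0]
    | succ n ih => exact ih.tail (hf n)
  have hcard : ∀ n, (f n).card = n := by
    intro n
    induction n with
    | zero => simp [h0]
    | succ n ih => rw [card_of_step (hr n) (hf n), ih]
  have h1 := Finset.card_le_univ (f (Fintype.card (I.toIUAP idx ψ).Bidder + 1))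
  rw [hcard] at h1
  omega

variable (I idx ψ) in
-- A reachable set of maximum cardinality admits no further step. Two final states bound each other
-- by `le_of_final`.
theorem existsUnique_isFinal : ∃! U, (I.toIUAP idx ψ).IsFinal U := by
  classical
  obtain ⟨U, hU, hmax⟩ := Set.exists_max_image
    {U | Relation.ReflTransGen (I.toIUAP idx ψ).Step ∅ U} Finset.card (Set.toFinite _)
    ⟨∅, Relation.ReflTransGen.refl⟩
  have hfin : (I.toIUAP idx ψ).IsFinal U := by
    refine ⟨hU, fun u hu => ?_⟩
    have hs : (I.toIUAP idx ψ).Step U _ := ⟨u, hu, rfl⟩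
    have h1 := hmax _ (Relation.ReflTransGen.tail hU hs)
    rw [card_of_step hU hs] at h1
    omega
  refine ⟨U, hfin, fun U' hU' => ?_⟩
  obtain ⟨c, h1, h2, h3⟩ := IsFinal.exists_reachable hfin
  obtain ⟨c', h1', h2', h3'⟩ := IsFinal.exists_reachable hU'
  have : c = c' := le_antisymm (h1.le_of_final h2') (h1'.le_of_final h2)
  ext u
  rw [h3, h3', this]

theorem exists_isGreedyMWM (h : (I.toIUAP idx ψ).IsFinal U) :
    ∃ M₀, ((I.toIUAP idx ψ).toUAP U).IsGreedyMWM M₀ := by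
  obtain ⟨c, -, -, hU⟩ := IsFinal.exists_reachable h
  obtain ⟨N, hN⟩ := (I.market idx ψ).exists_optimal c
  exact ⟨_, (isGreedyMWM_map hU).2 hN⟩

theorem reads_map_iff {μ : M → Option W} :
    I.Reads idx ψ (N.map (I.edge idx ψ)) μ ↔ ∀ i x, μ i = x ↔ (i, x) ∈ N := by
  refine forall_congr' fun i => forall_congr' fun x => iff_congr Iff.rfl ?_
  constructor
  · rintro ⟨k, h⟩
    obtain ⟨⟨j, y⟩, he, h⟩ := Finset.mem_map.1 h
    obtain ⟨h1, h2⟩ := Prod.mk.inj h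
    obtain rfl : j = i := (Sigma.mk.inj h1).1
    obtain rfl : y = x := item_injective h2
    exact he
  · exact fun h => ⟨⟨_, (I.manPref i).tier_lt_numTiers x⟩, Finset.mem_map.2 ⟨_, h, rfl⟩⟩

end SMIW

/-! ### Changing an optimal matching by one edge -/

namespace TieredMarket

variable {T V E : Type*} {A : TieredMarket T V E} {c : T → ℕ} {N : Finset E}

theorem Feasible.mono {N' : Finset E} (hN : A.Feasible c N) (h : N' ⊆ N) : A.Feasible c N' :=
  ⟨fun e he => hN.rank_lt e (h he), hN.label_inj.mono h, hN.item_inj.mono h⟩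

theorem Feasible.insert [DecidableEq E] (hN : A.Feasible c N) {e : E}
    (hr : A.rank e < c (A.agent e)) (hl : ∀ x ∈ N, A.label x ≠ A.label e)
    (hi : ∀ x ∈ N, A.item x ≠ A.item e) : A.Feasible c (insert e N) := by
  refine ⟨fun x hx => ?_, injOn_insert_of_ne hN.label_inj hl, injOn_insert_of_ne hN.item_inj hi⟩
  rcases Finset.mem_insert.1 hx with rfl | hx
  · exact hr
  · exact hN.rank_lt x hx

theorem Optimal.sum_value_le (hN : A.Optimal c N) {N' : Finset E} (hN' : A.Feasible c N') :
    ∑ e ∈ N', A.value e ≤ ∑ e ∈ N, A.value e :=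
  (hN.2 N' hN').elim le_of_lt fun h => h.1.le

theorem Optimal.value_nonneg (hN : A.Optimal c N) {e : E} (he : e ∈ N) : 0 ≤ A.value e := by
  classical
  have h1 := hN.sum_value_le (hN.1.mono (Finset.erase_subset e N))
  rw [← Finset.add_sum_erase N _ he] at h1
  linarith

theorem Optimal.value_le_of_free (hN : A.Optimal c N) {e : E}
    (hr : A.rank e < c (A.agent e)) (hl : ∀ x ∈ N, A.label x ≠ A.label e)
    (hi : ∀ x ∈ N, A.item x ≠ A.item e) : A.value e ≤ 0 := by
  classical
  have h1 := hN.sum_value_le (hN.1.insert hr hl hi)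
  rw [Finset.sum_insert fun h => hl e h rfl] at h1
  linarith

theorem Optimal.value_le_of_swap (hN : A.Optimal c N) {e e' : E} (he : e ∈ N)
    (hr : A.rank e' < c (A.agent e')) (hl : ∀ x ∈ N, A.label x ≠ A.label e')
    (hi : A.item e = A.item e') : A.value e' ≤ A.value e := by
  classical
  have h1 := hN.sum_value_le ((hN.1.mono (Finset.erase_subset e N)).insert hr
    (fun x hx => hl x (Finset.mem_of_mem_erase hx)) fun x hx h =>
      (Finset.mem_erase.1 hx).1 (hN.1.item_inj (Finset.mem_of_mem_erase hx) he (h.trans hi.symm)))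
  rw [Finset.sum_insert fun h => hl e' (Finset.mem_of_mem_erase h) rfl,
    ← Finset.add_sum_erase N _ he] at h1
  linarith

end TieredMarket

/-! ### Properties of the outcome of the marriage algorithm -/

namespace SMIW

variable {M W : Type*} [Fintype M] [Fintype W] {I : SMIW M W} {idx : M ≃ Fin (Fintype.card M)}
  {ψ : W → Option M → ℝ} {c : M → ℕ} {N : Finset (M × Option W)}

/-- A man whose dummy item has been bid on is matched. -/
theorem exists_mem_of_tier_none_lt (hN : (I.market idx ψ).Optimal c N) {i : M}
    (hi : (I.manPref i).tier none < c i) : ∃ x, (i, x) ∈ N := by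
  classical
  by_contra! hne
  have hag : ∀ e ∈ N, e.1 ≠ i := fun e he h => hne e.2 (h ▸ he)
  have hins := hN.1.insert (e := (i, none)) hi
    (fun e he h => hag e he (congrArg Prod.fst h)) (fun e he h => by
      obtain ⟨j, _ | w⟩ := e
      · exact hag _ he (Sum.inr_injective h)
      · exact Sum.inl_ne_inr h)
  -- Adding the free dummy edge keeps the value and strictly raises the priority, contradicting
  -- optimality.
  have hv : (I.market idx ψ).value (i, none) = 0 := rfl
  have h2 := hN.2 _ hins
  rw [Finset.sum_insert (hne none), Finset.sum_insert (hne none), hv, zero_add] at h2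
  have h3 := I.market_prio_pos idx ψ i
  have h4 : (I.market idx ψ).agent (i, none) = i := rfl
  rw [h4] at h2
  rcases h2 with h2 | h2
  · exact lt_irrefl _ h2
  · linarith [h2.2]

/-- Once the tier containing `none` is revealed, the man is matched in every optimal matching and
never advances again. This gives individual rationality for the men. -/
theorem le_tier_none (hc : (I.market idx ψ).Reachable I.tiers c) (i : M) :
    c i ≤ (I.manPref i).tier none + 1 := by
  classical
  induction hc with
  | refl => exact Nat.zero_le _
  | @tail c d _ hs ih =>
    obtain ⟨t, -, ht, rfl⟩ := hs
    by_cases hit : i = t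
    · subst hit
      rw [Function.update_self]
      by_contra! hlt
      obtain ⟨N, hN⟩ := (I.market idx ψ).exists_optimal c
      obtain ⟨x, hx⟩ := exists_mem_of_tier_none_lt hN (i := i) (by omega)
      exact ht N hN _ hx rfl
    · rw [Function.update_of_ne hit]; exact ih

/-- At the end every man is matched. -/
theorem exists_mem_of_final (hc' : (I.market idx ψ).Final I.tiers c)
    (hN : (I.market idx ψ).Optimal c N) (i : M) : ∃ x, (i, x) ∈ N := by
  by_cases hi : (I.manPref i).tier none < c i
  · exact exists_mem_of_tier_none_lt hN hi
  · have h1 := hc' i ((not_lt.1 hi).trans_lt ((I.manPref i).tier_lt_numTiers none))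
    simp only [TieredMarket.Waiting, not_forall, not_not] at h1
    obtain ⟨N', hN', e, he, hei⟩ := h1
    obtain ⟨x, hx, hxe⟩ := hN.exists_agent (I.market_prio_injective idx ψ)
      (I.market_prio_pos idx ψ) hN' he
    have hxi : x.1 = i := hxe.trans hei
    exact ⟨x.2, hxi ▸ hx⟩

/-- The final state `c`, the optimal matching `N`, and the assignment `μ` read off from `N`. -/
structure Outcome (I : SMIW M W) (idx : M ≃ Fin (Fintype.card M)) (ψ : W → Option M → ℝ)
    (c : M → ℕ) (N : Finset (M × Option W)) (μ : M → Option W) : Prop where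
  reachable : (I.market idx ψ).Reachable I.tiers c
  optimal : (I.market idx ψ).Optimal c N
  mem_iff : ∀ i x, (i, x) ∈ N ↔ μ i = x

theorem exists_outcome_of_isRun {U : Finset (I.toIUAP idx ψ).Bidder}
    {M₀ : Finset ((I.toIUAP idx ψ).Bidder × (W ⊕ M))} (h : I.IsRun idx ψ U M₀) :
    ∃ c N μ, I.Outcome idx ψ c N μ ∧ ∀ ν, I.Reads idx ψ M₀ ν ↔ ν = μ := by
  obtain ⟨c, hc, hf, hU⟩ := IsFinal.exists_reachable h.1
  obtain ⟨N, rfl⟩ := exists_eq_map h.2.1.1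
  have hN := (isGreedyMWM_map hU).1 h.2
  choose μ hμ using exists_mem_of_final hf hN
  have hiff : ∀ i x, (i, x) ∈ N ↔ μ i = x := by
    refine fun i x => ⟨fun hx => ?_, fun hx => hx ▸ hμ i⟩
    exact congrArg Prod.snd (hc.lastMatched.agent_injOn hN (hμ i) hx rfl)
  refine ⟨c, N, μ, ⟨hc, hN, hiff⟩, fun ν => ?_⟩
  rw [reads_map_iff]
  constructor
  · exact fun h => funext fun i => (h i _).2 (hμ i)
  · rintro rfl i x
    exact (hiff i x).symm

namespace Outcome

variable {μ : M → Option W}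

theorem mem (h : I.Outcome idx ψ c N μ) (i : M) : (i, μ i) ∈ N := (h.mem_iff i _).2 rfl

theorem tier_add_one (h : I.Outcome idx ψ c N μ) (i : M) : (I.manPref i).tier (μ i) + 1 = c i :=
  h.reachable.lastMatched N h.optimal _ (h.mem i)

theorem eq_of_some (h : I.Outcome idx ψ c N μ) {i j : M} {w : W} (hi : μ i = some w)
    (hj : μ j = some w) : i = j :=
  congrArg Prod.fst (h.optimal.1.item_inj ((h.mem_iff _ _).2 hi) ((h.mem_iff _ _).2 hj) rfl)

theorem ge_none (h : I.Outcome idx ψ c N μ) (i : M) : (I.manPref i).ge (μ i) none := by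
  have h1 := h.tier_add_one i
  have h2 := le_tier_none h.reachable i
  exact WeakPref.ge_iff_tier_le.2 (by omega)

theorem utility_nonneg (h : I.Outcome idx ψ c N μ) {i : M} {w : W} (hi : μ i = some w) :
    0 ≤ ψ w (some i) :=
  h.optimal.value_nonneg ((h.mem_iff _ _).2 hi)

theorem rank_lt (h : I.Outcome idx ψ c N μ) {i : M} {x : Option W} (hx : (I.manPref i).gt x (μ i)) :
    (I.manPref i).tier x < c i := by
  have h1 := h.tier_add_one i
  have h2 := WeakPref.tier_lt_tier hx
  omega

theorem label_ne (h : I.Outcome idx ψ c N μ) {i : M} {x : Option W}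
    (hx : (I.manPref i).gt x (μ i)) (e : M × Option W) (he : e ∈ N) :
    (I.market idx ψ).label e ≠ (I.market idx ψ).label (i, x) := by
  intro hl
  obtain ⟨j, y⟩ := e
  obtain rfl : j = i := congrArg Prod.fst hl
  obtain rfl := (h.mem_iff _ _).1 he
  exact (WeakPref.tier_lt_tier hx).ne' (congrArg Prod.snd hl)

/-- A strictly better tier of `i` is revealed but unmatched, so the edge of `i` to `w` could replace
that of `j` without any other change. -/
theorem utility_le_of_gt (h : I.Outcome idx ψ c N μ) {i j : M} {w : W}
    (hi : (I.manPref i).gt (some w) (μ i)) (hj : μ j = some w) :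
    ψ w (some i) ≤ ψ w (some j) :=
  h.optimal.value_le_of_swap ((h.mem_iff _ _).2 hj) (e' := (i, some w)) (h.rank_lt hi)
    (h.label_ne hi) rfl

theorem utility_nonpos_of_gt (h : I.Outcome idx ψ c N μ) {i : M} {w : W}
    (hi : (I.manPref i).gt (some w) (μ i)) (hw : ∀ j, μ j ≠ some w) : ψ w (some i) ≤ 0 :=
  h.optimal.value_le_of_free (e := (i, some w)) (h.rank_lt hi) (h.label_ne hi) fun e he hx => by
    obtain ⟨j, y⟩ := e
    have hy := (h.mem_iff _ _).1 he
    rcases y with _ | w'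
    · exact Sum.inr_ne_inl hx
    · have : w' = w := Sum.inl_injective hx
      exact hw j (this ▸ hy)

theorem sum_eq (h : I.Outcome idx ψ c N μ) (f : M × Option W → ℝ) :
    ∑ e ∈ N, f e = ∑ i, f (i, μ i) := by
  symm
  refine Finset.sum_bij (fun i _ => (i, μ i)) (fun i _ => h.mem i)
    (fun i _ j _ hij => congrArg Prod.fst hij) (fun e he => ?_) fun _ _ => rfl
  exact ⟨e.1, Finset.mem_univ _, Prod.ext rfl ((h.mem_iff e.1 e.2).1 he)⟩

/-- An assignment that no man finds worse has at most the same total value; if the values are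
equal, then no man finds it better. -/
theorem value_le_and (h : I.Outcome idx ψ c N μ) {ν : M → Option W}
    (hinj : ∀ i j w, ν i = some w → ν j = some w → i = j)
    (hge : ∀ i, (I.manPref i).ge (ν i) (μ i)) :
    ∑ i, (I.market idx ψ).value (i, ν i) ≤ ∑ i, (I.market idx ψ).value (i, μ i) ∧
      (∑ i, (I.market idx ψ).value (i, ν i) = ∑ i, (I.market idx ψ).value (i, μ i) →
        ∀ i, (I.manPref i).ge (μ i) (ν i)) := by
  classical
  let N' : Finset (M × Option W) := Finset.univ.image fun i => (i, ν i)
  have hmem : ∀ e ∈ N', e.2 = ν e.1 := by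
    intro e he
    obtain ⟨i, -, rfl⟩ := Finset.mem_image.1 he
    rfl
  have hsum : ∀ f : M × Option W → ℝ, ∑ e ∈ N', f e = ∑ i, f (i, ν i) := fun f =>
    Finset.sum_image fun i _ j _ hij => congrArg Prod.fst hij
  have hN' : (I.market idx ψ).Feasible c N' := by
    refine ⟨fun e he => ?_, fun e he e' he' hl => ?_, fun e he e' he' hl => ?_⟩
    · have h1 := h.tier_add_one e.1
      have h2 := WeakPref.tier_le_tier (hge e.1)
      rw [← hmem e he] at h2
      change (I.manPref e.1).tier e.2 < c e.1
      omega
    · have h1 : e.1 = e'.1 := (Prod.mk.inj hl).1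
      exact Prod.ext h1 (by rw [hmem e he, hmem e' he', h1])
    · have h1 := hmem e he
      have h1' := hmem e' he'
      obtain ⟨i, x⟩ := e
      obtain ⟨j, y⟩ := e'
      have hij : i = j := by
        rcases x with _ | w <;> rcases y with _ | w'
        · exact Sum.inr_injective hl
        · exact absurd hl Sum.inr_ne_inl
        · exact absurd hl Sum.inl_ne_inr
        · have : w = w' := Sum.inl_injective hl
          exact hinj i j w h1.symm (this ▸ h1'.symm)
      subst hij
      exact Prod.ext rfl (h1.trans h1'.symm)
  have h1 := h.optimal.sum_value_le hN'
  rw [hsum, h.sum_eq] at h1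
  refine ⟨h1, fun heq i => ?_⟩
  -- Both matchings match every man exactly once, so their priorities agree and equal value makes
  -- `N'` optimal. Then `LastMatched` puts every man in the same tier under both.
  have hopt : (I.market idx ψ).Optimal c N' := by
    refine ⟨hN', fun X hX => ?_⟩
    rw [hsum, hsum, heq, ← h.sum_eq]
    have h2 := h.optimal.2 X hX
    rwa [h.sum_eq fun e => (I.market idx ψ).prio ((I.market idx ψ).agent e)] at h2
  have h2 := h.reachable.lastMatched N' hopt (i, ν i)
    (Finset.mem_image_of_mem _ (Finset.mem_univ i))
  have h3 : (I.manPref i).tier (ν i) + 1 = c i := h2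
  have h4 := h.tier_add_one i
  exact WeakPref.ge_iff_tier_le.2 (by omega)

/-- No man gains by misreporting his preferences. -/
theorem ge_of_misreport (h : I.Outcome idx ψ c N μ) {I' : SMIW M W} {c' : M → ℕ}
    {N' : Finset (M × Option W)} {μ' : M → Option W} (h' : I'.Outcome idx ψ c' N' μ') (p : M)
    (hI : ∀ i, i ≠ p → I'.manPref i = I.manPref i) : (I.manPref p).ge (μ p) (μ' p) := by
  have h1 := TieredMarket.le_rank_of_misreport (A := I.market idx ψ) (B := I'.market idx ψ) p
    rfl rfl rfl rfl
    (fun e he => by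
      change (I'.manPref e.1).tier e.2 = (I.manPref e.1).tier e.2
      rw [hI e.1 he])
    h.reachable h'.reachable h'.optimal (fun i => ⟨_, h'.mem i, rfl⟩) (h'.mem p) rfl
  have h2 : c p ≤ (I.manPref p).tier (μ' p) + 1 := h1
  have h3 := h.tier_add_one p
  exact WeakPref.ge_iff_tier_le.2 (by omega)

end Outcome

end SMIW

/-! ### Group preferences are monotone in utility -/

section GroupPreferences

variable {P : Type*}

/-- Improvements with respect to `G` that do not decrease the total utility, and that are
reversible if they preserve it. -/
def UtilityMonotone (u : Option P → ℝ) (G : Finset P → Finset P → Prop) (S S' : Finset P) : Prop :=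
  G S S' ∧ ∑ p ∈ S', u (some p) ≤ ∑ p ∈ S, u (some p) ∧
    (∑ p ∈ S', u (some p) = ∑ p ∈ S, u (some p) → G S' S)

variable {u : Option P → ℝ} {G : Finset P → Finset P → Prop} {r : WeakPref (Option P)}

theorem UtilityMonotone.trans (hG : ∀ S₁ S₂ S₃, G S₁ S₂ → G S₂ S₃ → G S₁ S₃)
    {S₁ S₂ S₃ : Finset P} (h : UtilityMonotone u G S₁ S₂) (h' : UtilityMonotone u G S₂ S₃) :
    UtilityMonotone u G S₁ S₃ := by
  refine ⟨hG _ _ _ h.1 h'.1, h'.2.1.trans h.2.1, fun he => ?_⟩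
  have h1 := h.2.1
  have h2 := h'.2.1
  exact hG _ _ _ (h'.2.2 (by linarith)) (h.2.2 (by linarith))

theorem sum_addOpt (hu : u none = 0) {S : Finset P} {x : Option P} (hx : ∀ p ∈ S, x ≠ some p) :
    ∑ p ∈ addOpt S x, u (some p) = u x + ∑ p ∈ S, u (some p) := by
  classical
  rcases x with _ | p
  · simp [addOpt, hu]
  · exact Finset.sum_insert fun h => hx p h rfl

/-- `UtilityMonotone u G` is itself a responsive relation contained in `G`, so minimality makes it
all of `G`. -/
theorem MinimallyResponsive.utilityMonotone (hG : MinimallyResponsive r G) (hu : u none = 0)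
    (hr : ∀ x y, r.ge x y ↔ u y ≤ u x) {S S' : Finset P} (h : G S S') :
    UtilityMonotone u G S S' := by
  refine hG.2 (UtilityMonotone u G) ⟨fun S => ⟨hG.1.refl S, le_rfl, fun _ => hG.1.refl S⟩,
    fun _ _ _ => UtilityMonotone.trans hG.1.trans, fun S x y hx hy => ?_⟩ (fun _ _ h => h.1) _ _ h
  refine ⟨fun hxy => ⟨(hG.1.iff S x y hx hy).1 hxy, ?_, fun he => ?_⟩,
    fun hxy => (hG.1.iff S x y hx hy).2 hxy.1⟩
  · rw [sum_addOpt hu hx, sum_addOpt hu hy]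
    have := (hr x y).1 hxy
    linarith
  · rw [sum_addOpt hu hx, sum_addOpt hu hy] at he
    exact (hG.1.iff S y x hy hx).1 ((hr y x).2 (by linarith))

theorem MinimallyOneSidedResponsive.utilityMonotone (hG : MinimallyOneSidedResponsive r G)
    (hnone : ∀ p, ¬ r.indiff (some p) none) (hu : u none = 0)
    (hr : ∀ x y, r.ge x y ↔ u y ≤ u x) {S S' : Finset P} (h : G S S') :
    UtilityMonotone u G S S' := by
  classical
  have hsum : ∀ {S : Finset P} {p : P}, p ∉ S →
      ∑ p ∈ insert p S, u (some p) = u (some p) + ∑ p ∈ S, u (some p) :=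
    fun hp => Finset.sum_insert hp
  refine hG.2 (UtilityMonotone u G) ⟨fun S => ⟨hG.1.refl S, le_rfl, fun _ => hG.1.refl S⟩,
    fun _ _ _ => UtilityMonotone.trans hG.1.trans, fun S p hp => ?_, fun S p p' hp hp' => ?_⟩
    (fun _ _ h => h.1) _ _ h
  · have h1 := hG.1.iff_vacancy S p hp
    refine ⟨fun hge => ⟨?_, ?_, fun he => ?_⟩, fun hge => h1.2 ?_⟩
    · convert h1.1 hge
    · have h2 := (hr _ _).1 hge
      have h3 := hsum hp
      rw [hu] at h2
      convert (by linarith : ∑ p ∈ S, u (some p) ≤ ∑ p ∈ insert p S, u (some p))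
    -- One-sided responsiveness cannot reverse the addition of a student. Equal utility would mean
    -- indifference between `p` and a vacancy, which `hnone` excludes.
    · refine absurd ⟨hge, (hr _ _).2 ?_⟩ (hnone p)
      have h3 := hsum hp
      have he : ∑ p ∈ S, u (some p) = ∑ p ∈ insert p S, u (some p) := by convert he
      rw [hu]
      linarith
    · convert hge.1
  · have h1 := hG.1.iff_swap S p p' hp hp'
    have h1' := hG.1.iff_swap S p' p hp' hp
    have h3 := hsum hp
    have h3' := hsum hp'
    refine ⟨fun hge => ⟨?_, ?_, fun he => ?_⟩, fun hge => h1.2 ?_⟩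
    · convert h1.1 hge
    · have h2 := (hr _ _).1 hge
      convert (by linarith : ∑ p ∈ insert p' S, u (some p) ≤ ∑ p ∈ insert p S, u (some p))
    · have he : ∑ p ∈ insert p' S, u (some p) = ∑ p ∈ insert p S, u (some p) := by convert he
      have := h1'.1 ((hr _ _).2 (by linarith))
      convert this
    · convert hge.1

theorem InducedByAdditive.utilityMonotone (hG : InducedByAdditive u G) {S S' : Finset P}
    (h : G S S') : UtilityMonotone u G S S' :=
  ⟨h, (hG _ _).1 h, fun he => (hG _ _).2 he.ge⟩

end GroupPreferences

/-! ### From slots back to colleges -/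

namespace CAW

variable {P Q : Type*} [Fintype P] {I : CAW P Q}

theorem mem_group {μ : P → Option Q} {q : Q} {p : P} : p ∈ group μ q ↔ μ p = some q := by
  classical
  exact Finset.mem_filter.trans (and_iff_right (Finset.mem_univ _))

theorem isMatching_of_injective {μ : P → Option Q} {μ₀ : P → Option I.Slot}
    (hμ : ∀ p, μ p = (μ₀ p).map Sigma.fst)
    (hinj : ∀ i j s, μ₀ i = some s → μ₀ j = some s → i = j) : I.IsMatching μ := by
  intro q
  have hex : ∀ p : {p // p ∈ group μ q}, ∃ k : Fin (I.capacity q), μ₀ p = some ⟨q, k⟩ := by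
    rintro ⟨p, hp⟩
    have h1 := mem_group.1 hp
    rw [hμ, Option.map_eq_some_iff] at h1
    obtain ⟨⟨q', k⟩, h1, rfl⟩ := h1
    exact ⟨k, h1⟩
  choose k hk using hex
  have hkinj : Function.Injective k := fun x y hxy =>
    Subtype.ext (hinj _ _ _ (hk x) (hxy ▸ hk y))
  simpa using Fintype.card_le_of_injective k hkinj

/-- The students of a matching can be seated in distinct slots. -/
theorem IsMatching.exists_slots {μ : P → Option Q} (h : I.IsMatching μ) :
    ∃ μ₀ : P → Option I.Slot, (∀ p, μ p = (μ₀ p).map Sigma.fst) ∧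
      ∀ i j s, μ₀ i = some s → μ₀ j = some s → i = j := by
  classical
  have hemb : ∀ q, Nonempty ({p // p ∈ group μ q} ↪ Fin (I.capacity q)) := fun q =>
    Function.Embedding.nonempty_of_card_le (by simpa using h q)
  have hex : ∀ p, ∃ y : Option I.Slot, μ p = y.map Sigma.fst ∧
      ∀ q (hp : p ∈ group μ q), y = some ⟨q, (hemb q).some ⟨p, hp⟩⟩ := by
    intro p
    rcases hp : μ p with _ | q
    · refine ⟨none, rfl, fun q hq => ?_⟩
      rw [mem_group, hp] at hq
      cases hq
    · refine ⟨some ⟨q, (hemb q).some ⟨p, mem_group.2 hp⟩⟩, rfl, fun q' hq' => ?_⟩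
      obtain rfl : q = q' := by
        rw [mem_group, hp] at hq'
        exact Option.some_injective _ hq'
      rfl
  choose μ₀ h1 h2 using hex
  refine ⟨μ₀, h1, fun i j s hi hj => ?_⟩
  have hgi : i ∈ group μ s.1 := mem_group.2 (by rw [h1, hi]; rfl)
  have hgj : j ∈ group μ s.1 := mem_group.2 (by rw [h1, hj]; rfl)
  have h3 := (h2 i _ hgi).symm.trans (hi.trans (hj.symm.trans (h2 j _ hgj)))
  have h4 := eq_of_heq (Sigma.mk.inj (Option.some_injective _ h3)).2
  exact congrArg Subtype.val ((hemb s.1).some.injective h4)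

variable [Fintype Q] {idx : P ≃ Fin (Fintype.card P)} {ψ : Q → Option P → ℝ}

/-- The market value depends only on the colleges, not on the seating, so any seating of a competing
matching may be used in the comparison. -/
theorem sum_value_eq (μ₀ : P → Option I.Slot) {μ : P → Option Q}
    (hμ : ∀ p, μ p = (μ₀ p).map Sigma.fst) :
    ∑ p, (I.toSMIW.market idx (I.slotUtility ψ)).value (p, μ₀ p) =
      ∑ q, ∑ p ∈ group μ q, ψ q (some p) := by
  classical
  have h1 : ∀ q, ∑ p ∈ group μ q, ψ q (some p) = ∑ p, if μ p = some q then ψ q (some p) else 0 := by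
    intro q
    rw [← Finset.sum_filter]
    exact Finset.sum_congr (by ext p; simp [mem_group]) fun _ _ => rfl
  simp_rw [h1]
  rw [Finset.sum_comm]
  refine Finset.sum_congr rfl fun p _ => ?_
  rw [hμ p]
  rcases μ₀ p with _ | s
  · simp [SMIW.market]
  · simp [SMIW.market, slotUtility]

variable {c : P → ℕ} {N : Finset (P × Option I.Slot)} {μ₀ : P → Option I.Slot} {μ : P → Option Q}

theorem weaklyStable_of_outcome (hψ : I.IsUtilityAssignment ψ)
    (h : I.toSMIW.Outcome idx (I.slotUtility ψ) c N μ₀) (hμ : ∀ p, μ p = (μ₀ p).map Sigma.fst) :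
    I.WeaklyStable μ := by
  refine ⟨fun p q hpq => ?_, fun p q hb => ?_⟩
  · have h1 := hpq
    rw [hμ, Option.map_eq_some_iff] at h1
    obtain ⟨s, hs, rfl⟩ := h1
    constructor
    · have h2 : (I.studentPref p).ge ((μ₀ p).map Sigma.fst) none := h.ge_none p
      rwa [← hμ, hpq] at h2
    · rw [(hψ s.1).2, (hψ s.1).1]
      exact h.utility_nonneg hs
  · obtain ⟨hgt, hb⟩ := hb
    have hslot : ∀ k : Fin (I.capacity q), (I.toSMIW.manPref p).gt (some ⟨q, k⟩) (μ₀ p) := by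
      intro k
      rw [hμ] at hgt
      exact hgt
    rcases hb with ⟨p', hp', hgt'⟩ | ⟨hcard, hgt'⟩
    · rw [hμ, Option.map_eq_some_iff] at hp'
      obtain ⟨⟨q, k⟩, hs, rfl⟩ := hp'
      exact hgt'.2 (((hψ q).2 _ _).2 (h.utility_le_of_gt (hslot k) hs))
    -- A college below capacity has an empty slot, to which the one-edge insertion applies.
    · obtain ⟨k, hk⟩ : ∃ k : Fin (I.capacity q), ∀ j, μ₀ j ≠ some ⟨q, k⟩ := by
        by_contra! hall
        choose j hj using hall
        have hjinj : Function.Injective j := by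
          intro a b hab
          have h1 := (hj a).symm.trans (hab ▸ hj b)
          exact eq_of_heq (Sigma.mk.inj (Option.some_injective _ h1)).2
        have h1 := Finset.card_le_card_of_injOn (s := Finset.univ) (t := group μ q) j
          (fun a _ => Finset.mem_coe.2 (mem_group.2 (by rw [hμ, hj]; rfl))) hjinj.injOn
        simp only [Finset.card_univ, Fintype.card_fin] at h1
        omega
      refine hgt'.2 (((hψ q).2 _ _).2 ?_)
      rw [(hψ q).1]
      exact h.utility_nonpos_of_gt (hslot k) hk

/-- A dominating matching gives every college at least as much utility, yet by `value_le_and` no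
larger total. Equality thus holds at every college, and then neither students nor colleges gain
strictly. -/
theorem paretoOptimal_of_outcome {G : Q → Finset P → Finset P → Prop}
    (hG : ∀ q S S', G q S S' → UtilityMonotone (ψ q) (G q) S S')
    (h : I.toSMIW.Outcome idx (I.slotUtility ψ) c N μ₀) (hμ : ∀ p, μ p = (μ₀ p).map Sigma.fst) :
    I.ParetoOptimal G μ := by
  rintro μ' hμ' ⟨⟨hP, hQ⟩, hnot⟩
  obtain ⟨ν, hν, hinj⟩ := hμ'.exists_slots
  obtain ⟨h1, h2⟩ := h.value_le_and hinj fun p => by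
    have := hP p
    rw [hμ, hν] at this
    exact this
  rw [sum_value_eq ν hν, sum_value_eq μ₀ hμ] at h1 h2
  have hle : ∀ q ∈ Finset.univ, ∑ p ∈ group μ q, ψ q (some p) ≤ ∑ p ∈ group μ' q, ψ q (some p) :=
    fun q _ => (hG q _ _ (hQ q)).2.1
  have heq := le_antisymm h1 (Finset.sum_le_sum hle)
  refine hnot ⟨fun p => ?_, fun q => (hG q _ _ (hQ q)).2.2 ?_⟩
  · rw [hμ, hν]
    exact h2 heq p
  · exact (Finset.sum_eq_sum_iff_of_le hle).1 heq.symm q (Finset.mem_univ q)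

theorem IsOutput.exists_outcome (h : I.IsOutput idx ψ μ) :
    ∃ c N μ₀, I.toSMIW.Outcome idx (I.slotUtility ψ) c N μ₀ ∧ ∀ p, μ p = (μ₀ p).map Sigma.fst := by
  obtain ⟨U, M₀, hrun, ν, hν, hμ⟩ := h
  obtain ⟨c, N, μ₀, hout, hreads⟩ := SMIW.exists_outcome_of_isRun hrun
  obtain rfl := (hreads ν).1 hν
  exact ⟨c, N, ν, hout, hμ⟩

variable (I idx ψ) in
theorem producesMatching : I.ProducesMatching idx ψ := by
  refine ⟨SMIW.terminates _ _ _, SMIW.existsUnique_isFinal _ _ _,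
    fun U hU => SMIW.exists_isGreedyMWM hU, fun U M₀ hrun => ?_⟩
  obtain ⟨c, N, μ₀, hout, hreads⟩ := SMIW.exists_outcome_of_isRun hrun
  refine ⟨fun p => (μ₀ p).map Sigma.fst,
    isMatching_of_injective (fun _ => rfl) fun _ _ _ => hout.eq_of_some, fun ν => ?_⟩
  constructor
  · rintro ⟨ν₀, h1, h2⟩
    obtain rfl := (hreads ν₀).1 h1
    exact funext h2
  · rintro rfl
    exact ⟨μ₀, (hreads μ₀).2 rfl, fun _ => rfl⟩

theorem ge_of_misreport {p : P} {r : WeakPref (Option Q)} {μ' : P → Option Q}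
    (h : I.IsOutput idx ψ μ) (h' : (I.misreport p r).IsOutput idx ψ μ') :
    (I.studentPref p).ge (μ p) (μ' p) := by
  obtain ⟨c, N, μ₀, hout, hμ⟩ := h.exists_outcome
  obtain ⟨c', N', μ₀', hout', hμ'⟩ := h'.exists_outcome
  have h1 := hout.ge_of_misreport (I' := (I.misreport p r).toSMIW) hout' p fun i hi => by
    classical
    have h2 : (I.misreport p r).studentPref i = I.studentPref i :=
      Function.update_of_ne hi _ _
    exact congrArg (WeakPref.comap (Option.map Sigma.fst)) h2
  rw [hμ, hμ']
  exact h1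

end CAW

theorem theorem2 {P Q : Type*} [Fintype P] [Fintype Q]
    (idx : P ≃ Fin (Fintype.card P)) (I : CAW P Q)
    (ψ : Q → Option P → ℝ) (hψ : I.IsUtilityAssignment ψ)
    (G : Q → Finset P → Finset P → Prop)
    (hG : ∀ q, MinimallyResponsive (I.collegePref q) (G q) ∨
      (MinimallyOneSidedResponsive (I.collegePref q) (G q) ∧
        ∀ p, ¬ (I.collegePref q).indiff (some p) none) ∨
      InducedByAdditive (ψ q) (G q)) :
    I.ProducesMatching idx ψ ∧
    (∀ μ, I.IsOutput idx ψ μ → I.ParetoStable G μ) ∧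
    (∀ (p : P) (r : WeakPref (Option Q)) (μ μ' : P → Option Q),
      I.IsOutput idx ψ μ → (I.misreport p r).IsOutput idx ψ μ' →
        (I.studentPref p).ge (μ p) (μ' p)) := by
  have hmono : ∀ q S S', G q S S' → UtilityMonotone (ψ q) (G q) S S' := by
    intro q S S' h
    rcases hG q with hq | ⟨hq, hnone⟩ | hq
    · exact hq.utilityMonotone (hψ q).1 (hψ q).2 h
    · exact hq.utilityMonotone hnone (hψ q).1 (hψ q).2 h
    · exact hq.utilityMonotone h
  refine ⟨I.producesMatching idx ψ, fun μ hμ => ?_, fun p r μ μ' h h' => CAW.ge_of_misreport h h'⟩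
  obtain ⟨c, N, μ₀, hout, hμ₀⟩ := hμ.exists_outcome
  exact ⟨CAW.paretoOptimal_of_outcome hmono hout hμ₀, CAW.weaklyStable_of_outcome hψ hout hμ₀⟩
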